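/- **Setting.** Let $Q=[0,1)^3$, $Q'=[-\pi,\pi)^3$, $e_\kappa(x)=e^{i\kappa\cdot x}$. Let $\mu$ be a $Q$-periodic Borel measure on $\mathbb R^3$ with $\mu(Q)=1$ such that $\int_Q\partial_j\varphi\,d\mu=0$ for all $\varphi\in C^\infty_\#(Q)$ and $j=1,2,3$, where $C^\infty_\#(Q)$ denotes the smooth $Q$-periodic functions and $C^\infty_{\#,0}(Q)$ those of zero $\mu$-mean over $Q$. Let $A$ (the inverse permittivity) be a differentiable $Q$-periodic function on $\mathbb R^3$ whose values are real symmetric positive definite $3\times3$ matrices (it is then bounded and uniformly positive); the permeability is $1$. *Spaces.* $H^1_{\operatorname{curl}A^{1/2},\kappa}$ is the closure in $L^2(Q,d\mu)^3\oplus L^2(Q,d\mu)^3$ of the pairs $(e_\kappa\varphi,\operatorname{curl}(e_\kappa A^{1/2}\varphi))$ with $A^{1/2}\varphi$ smooth and $Q$-periodic. A scalar function $\psi$ lies in $H^1_{\#,0}$ with $\nabla(e_\kappa\psi)=p$ if $(e_\kappa\psi,p)$ lies in the $L^2(Q,d\mu)$-closure of the pairs $(e_\kappa\varphi,\nabla(e_\kappa\varphi))$,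 $\varphi\in C^\infty_{\#,0}(Q)$. *Data.* For $\varepsilon>0$ and $\theta\in\varepsilon^{-1}Q'$ put $\kappa=\varepsilon\theta$, and let $G\in L^2(Q,d\mu)^3$ satisfy $\overline{e_\kappa}\operatorname{div}(e_\kappa G)=0$, that is, $\int_Q e_\kappa G\cdot\overline{\nabla(e_\kappa\varphi)}\,d\mu=0$ for all $\varphi\in C^\infty_\#(Q)$. *Transformed Maxwell system.* $(D^\varepsilon_\theta,B^\varepsilon_\theta)$ solves $$\varepsilon^{-1}\overline{e_\kappa}\operatorname{curl}(e_\kappa A^{1/2}D^\varepsilon_\theta)+B^\varepsilon_\theta=0,\qquad \varepsilon^{-1}A^{1/2}\overline{e_\kappa}\operatorname{curl}(e_\kappa B^\varepsilon_\theta)-D^\varepsilon_\theta=A^{1/2}G,$$ meaning that there is a $V$ with $(e_\kappa D^\varepsilon_\theta,V)\in H^1_{\operatorname{curl}A^{1/2},\kappa}$ and $B^\varepsilon_\theta=-\varepsilon^{-1}\overline{e_\kappa}V$, and that for all $(e_\kappa\varphi,v)\in H^1_{\operatorname{curl}A^{1/2},\kappa}$ $$\varepsilon^{-1}\int_Q e_\kappa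 B^\varepsilon_\theta\cdot\overline{v}\,d\mu-\int_Q D^\varepsilon_\theta\cdot\overline{\varphi}\,d\mu=\int_Q A^{1/2}G\cdot\overline\varphi\,d\mu .$$ Since the permeability is $1$, the transformed magnetic induction $B^\varepsilon_\theta$ is also the transformed magnetic field. *Effective vector.* $\Psi_\kappa=(\Psi_{\kappa,1},\Psi_{\kappa,2},\Psi_{\kappa,3})$, with components in $H^1_{\#,0}$, solves the cell problem $\overline{e_\kappa}\operatorname{div}A^{-1}(\nabla(e_\kappa\Psi_\kappa)+e_\kappa I)=0$, that is, $\int_Q A^{-1}(\nabla(e_\kappa\Psi_{\kappa,j})+e_\kappa \mathbf e_j)\cdot\overline{\nabla(e_\kappa\varphi)}\,d\mu=0$ for all $\varphi\in C^\infty_{\#,0}(Q)$ and $j=1,2,3$, where $\mathbf e_j$ is the $j$-th unit vector. Put $$\widehat A^{\rm hom}_\kappa=\int_Q A^{-1}\bigl(\overline{e_\kappa}\nabla(e_\kappa\Psi_\kappa)+I\bigr)d\mu,\qquad d^\varepsilon_\theta=\bigl(\widehat A^{\rm hom}_{\kappa}\bigr)^{-1}\bigl(i\theta\times i\theta\times(\widehat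 A^{\rm hom}_{\kappa})^{-1}+I\bigr)^{-1}\int_Q G\,d\mu ,$$ where the $j$-th column of $\nabla(e_\kappa\Psi_\kappa)$ is $\nabla(e_\kappa\Psi_{\kappa,j})$. **Theorem.** The cell problem is solvable for every $\kappa\in Q'$, the transformed Maxwell system is solvable for all $\varepsilon,\theta,G$ as above, and the two matrices inverted in the definition of $d^\varepsilon_\theta$ are invertible. There is a constant $C>0$, independent of $\varepsilon>0$, $\theta\in\varepsilon^{-1}Q'$ and $G$, such that for all such $\varepsilon,\theta,G$ and all solutions $$\bigl\|B^\varepsilon_\theta-i\theta\times d^\varepsilon_\theta\bigr\|_{L^2(Q,d\mu)}\le C\,\varepsilon\,\|G\|_{L^2(Q,d\mu)} .$$ -/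

import Mathlib

open MeasureTheory
open scoped ContDiff ENNReal

noncomputable section

namespace PeriodicMaxwell

/-- Points of the physical space. -/
abbrev R3 := Fin 3 → ℝ

/-- Complex vectors with the Euclidean norm. -/
abbrev C3 := EuclideanSpace ℂ (Fin 3)

/-- The periodicity cell `Q = [0,1)³`. -/
def cell : Set R3 := {x | ∀ i, x i ∈ Set.Ico (0 : ℝ) 1}

/-- The dual cell `Q' = [-π,π)³`. -/
def dualCell : Set R3 := {k | ∀ i, k i ∈ Set.Ico (-Real.pi) Real.pi}

/-- `Q`-periodicity of a function on space. -/
def IsPeriodic {β : Type*} (f : R3 → β) : Prop :=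
  ∀ (n : Fin 3 → ℤ) (x : R3), f (x + fun i => (n i : ℝ)) = f x

/-- `Q`-periodicity of a Borel measure on space. -/
def IsPeriodicMeasure (μ : Measure R3) : Prop :=
  ∀ n : Fin 3 → ℤ, μ.map (fun x => x + fun i => (n i : ℝ)) = μ

/-- The measure `μ` on the cell `Q`. -/
def onCell (μ : Measure R3) : Measure R3 := μ.restrict cell

/-- The partial derivative `∂_j f`. -/
def pderiv (j : Fin 3) (f : R3 → ℂ) (x : R3) : ℂ := fderiv ℝ f x (Pi.single j 1)

/-- The gradient of a scalar function. -/
def grad (f : R3 → ℂ) (x : R3) : C3 := WithLp.toLp 2 fun j => pderiv j f x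

/-- The curl of a vector function. -/
def curl (u : R3 → C3) (x : R3) : C3 :=
  !₂[pderiv 1 (fun y => u y 2) x - pderiv 2 (fun y => u y 1) x,
     pderiv 2 (fun y => u y 0) x - pderiv 0 (fun y => u y 2) x,
     pderiv 0 (fun y => u y 1) x - pderiv 1 (fun y => u y 0) x]

/-- The exponential `e_κ(x) = exp(i κ·x)`. -/
def expo (κ : R3) (x : R3) : ℂ := Complex.exp (Complex.I * ((∑ i, κ i * x i : ℝ) : ℂ))

/-- Smooth `Q`-periodic functions, with values in `ℂ` or in `ℂ³`. -/
def SmoothPer {E : Type*} [NormedAddCommGroup E] [NormedSpace ℝ E] (φ : R3 → E) : Prop :=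
  ContDiff ℝ ∞ φ ∧ IsPeriodic φ

/-- Smooth `Q`-periodic scalar functions with zero `μ`-mean over `Q`. -/
def SmoothPerZero (μ : Measure R3) (φ : R3 → ℂ) : Prop :=
  SmoothPer φ ∧ ∫ x, φ x ∂(onCell μ) = 0

/-- Multiplication of a complex vector by a real matrix. -/
def act (M : Matrix (Fin 3) (Fin 3) ℝ) (v : C3) : C3 :=
  WithLp.toLp 2 ((M.map Complex.ofReal).mulVec v.ofLp)

/-- The matrix square root `M^{1/2}` (of a positive semidefinite symmetric matrix). -/
def msqrt (M : Matrix (Fin 3) (Fin 3) ℝ) : Matrix (Fin 3) (Fin 3) ℝ := cfc Real.sqrt M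

/-- The closure in `L²(ν) ⊕ L²(ν)` of a set of pairs of functions. -/
def pairClosure {E F : Type*} [NormedAddCommGroup E] [NormedAddCommGroup F]
    (ν : Measure R3) (S : Set ((R3 → E) × (R3 → F))) : Set ((R3 → E) × (R3 → F)) :=
  {p | MemLp p.1 2 ν ∧ MemLp p.2 2 ν ∧ ∀ δ : ℝ≥0∞, 0 < δ →
    ∃ q ∈ S, eLpNorm (p.1 - q.1) 2 ν < δ ∧ eLpNorm (p.2 - q.2) 2 ν < δ}

/-- The Sobolev space of the pairs `(e_κ ψ, ∇(e_κ ψ))` with `ψ` periodic of zero mean: the closure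
of these pairs for smooth `ψ`. -/
def H1Zero (μ : Measure R3) (κ : R3) : Set ((R3 → ℂ) × (R3 → C3)) :=
  pairClosure (onCell μ)
    {q | ∃ φ : R3 → ℂ, SmoothPerZero μ φ ∧
      q = (fun x => expo κ x * φ x, grad fun x => expo κ x * φ x)}

/-- The space `H¹_{curl A^{1/2},κ}(Q,dμ)`: the closure of the pairs
`(e_κ φ, curl (e_κ A^{1/2} φ))` with `A^{1/2} φ` smooth and periodic. -/
def H1Curl (μ : Measure R3) (A : R3 → Matrix (Fin 3) (Fin 3) ℝ) (κ : R3) :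
    Set ((R3 → C3) × (R3 → C3)) :=
  pairClosure (onCell μ)
    {q | ∃ φ : R3 → C3, SmoothPer (fun x => act (msqrt (A x)) (φ x)) ∧
      q = (fun x => expo κ x • φ x, curl fun x => expo κ x • act (msqrt (A x)) (φ x))}

/-- The measures considered: `Q`-periodic, of unit mass on `Q`, and such that derivatives of
smooth periodic functions have zero mean. -/
structure Admissible (μ : Measure R3) : Prop where
  periodic : IsPeriodicMeasure μ
  mass : μ cell = 1
  grad_mean : ∀ φ : R3 → ℂ, SmoothPer φ → ∀ j, ∫ x, pderiv j φ x ∂(onCell μ) = 0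

/-- The inverse permittivity: a differentiable periodic real matrix function with symmetric
positive definite values (it is then automatically bounded and uniformly positive). -/
structure IsCoefficient (A : R3 → Matrix (Fin 3) (Fin 3) ℝ) : Prop where
  differentiable : ∀ i j, Differentiable ℝ fun x => A x i j
  periodic : IsPeriodic A
  posDef : ∀ x, (A x).PosDef

/-- `G ∈ L²(Q,dμ)` with `e_κ⁻¹ div (e_κ G) = 0`:
`∫ e_κ G · conj ∇(e_κ φ) dμ = 0` for all smooth periodic `φ`.
(`inner ℂ a b` is `b · conj a`.) -/
def IsCurrent (μ : Measure R3) (κ : R3) (G : R3 → C3) : Prop :=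
  MemLp G 2 (onCell μ) ∧ ∀ φ : R3 → ℂ, SmoothPer φ →
    ∫ x, inner ℂ (grad (fun y => expo κ y * φ y) x) (expo κ x • G x) ∂(onCell μ) = 0

/-- The cell problem `div A⁻¹ (∇(e_κ Ψ) + e_κ I) = 0` for the vector `Ψ` of zero-mean functions,
where `P j` stands for `∇(e_κ Ψ_j)`. -/
def IsCellSolution (μ : Measure R3) (A : R3 → Matrix (Fin 3) (Fin 3) ℝ) (κ : R3)
    (Ψ : Fin 3 → R3 → ℂ) (P : Fin 3 → R3 → C3) : Prop :=
  ∀ j, ((fun x => expo κ x * Ψ j x, P j) : (R3 → ℂ) × (R3 → C3)) ∈ H1Zero μ κ ∧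
    ∀ φ : R3 → ℂ, SmoothPerZero μ φ →
      ∫ x, inner ℂ (grad (fun y => expo κ y * φ y) x)
        (act (A x)⁻¹ (P j x + expo κ x • EuclideanSpace.single j 1)) ∂(onCell μ) = 0

/-- The matrix `Â_κ^hom = ∫ A⁻¹ (e_κ⁻¹ ∇(e_κ Ψ_κ) + I) dμ`, with `P j = ∇(e_κ Ψ_j)`; its `j`-th
column is `∫ A⁻¹ (e_κ⁻¹ ∇(e_κ Ψ_j) + e_j) dμ`. -/
def homMatrix (μ : Measure R3) (A : R3 → Matrix (Fin 3) (Fin 3) ℝ) (κ : R3)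
    (P : Fin 3 → R3 → C3) : Matrix (Fin 3) (Fin 3) ℂ :=
  Matrix.of fun i j =>
    ∫ x, act (A x)⁻¹ ((expo κ x)⁻¹ • P j x + EuclideanSpace.single j 1) i ∂(onCell μ)

/-- The matrix of `v ↦ iθ × v`. -/
def crossMatrix (θ : R3) : Matrix (Fin 3) (Fin 3) ℂ :=
  LinearMap.toMatrix' (crossProduct fun i => Complex.I * (θ i : ℂ))

/-- The matrix `iθ × iθ × M⁻¹ + I`. -/
def symbolMatrix (θ : R3) (M : Matrix (Fin 3) (Fin 3) ℂ) : Matrix (Fin 3) (Fin 3) ℂ :=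
  crossMatrix θ * crossMatrix θ * M⁻¹ + 1

/-- The vector `d = M⁻¹ (iθ × iθ × M⁻¹ + I)⁻¹ ∫ G dμ`. -/
def dVec (μ : Measure R3) (θ : R3) (M : Matrix (Fin 3) (Fin 3) ℂ) (G : R3 → C3) : C3 :=
  WithLp.toLp 2 ((M⁻¹ * (symbolMatrix θ M)⁻¹).mulVec (∫ x, G x ∂(onCell μ)).ofLp)

/-- The vector `iθ × d`. -/
def iCross (θ : R3) (d : C3) : C3 := WithLp.toLp 2 ((crossMatrix θ).mulVec d.ofLp)

/-- `(D, B)` solves the transformed Maxwell system with `κ = εθ`: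
`ε⁻¹ e_κ⁻¹ curl (e_κ A^{1/2} D) + B = 0` and
`ε⁻¹ A^{1/2} e_κ⁻¹ curl (e_κ B) - D = A^{1/2} G`, the second equation being tested against all
`(e_κ φ, v)`, `v = curl (e_κ A^{1/2} φ)`, of the space `H¹_{curl A^{1/2},κ}`. -/
def IsMaxwellSolution (μ : Measure R3) (A : R3 → Matrix (Fin 3) (Fin 3) ℝ) (ε : ℝ) (θ : R3)
    (G D B : R3 → C3) : Prop :=
  (∃ V : R3 → C3,
    ((fun x => expo (ε • θ) x • D x, V) : (R3 → C3) × (R3 → C3)) ∈ H1Curl μ A (ε • θ) ∧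
    ∀ᵐ x ∂(onCell μ), (ε : ℂ)⁻¹ • (expo (ε • θ) x)⁻¹ • V x + B x = 0) ∧
  ∀ φ v : R3 → C3,
    ((fun x => expo (ε • θ) x • φ x, v) : (R3 → C3) × (R3 → C3)) ∈ H1Curl μ A (ε • θ) →
    (ε : ℂ)⁻¹ * (∫ x, inner ℂ (v x) (expo (ε • θ) x • B x) ∂(onCell μ))
        - ∫ x, inner ℂ (φ x) (D x) ∂(onCell μ)
      = ∫ x, inner ℂ (φ x) (act (msqrt (A x)) (G x)) ∂(onCell μ)

end PeriodicMaxwell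

end

noncomputable section

namespace PeriodicMaxwell

/-! ### Exponentials and derivatives -/

/-! The hypothesis that periodic derivatives have zero mean makes the exponentials with frequencies
`ξ ∈ κ + 2πℤ³` orthonormal in `L²(Q,dμ)`; Stone–Weierstrass makes them complete (`expoBasis`). Hence
Parseval holds (`hasSum_inner_coef`), and on Fourier coefficients the gradient is multiplication by
`iξ` and the curl is `iξ ×` (`coef_grad`, `coef_curl`), also for elements of the closures.

Put `E = e_κ A^{1/2} D`, `F = e_κ A^{-1/2} D = A⁻¹ E`, `b = e_κ B`, and write `g` for `e_κ G`. The
Maxwell system says `iξ × Ê = -ε b̂` and `iξ × b̂ = ε (F̂ + ĝ)` in every mode, so `b̂` and, as `g`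
is divergence free, `F̂` are orthogonal to `ξ`. For `κ ∈ Q'` every frequency other than `κ` has
length at least `π` (`sq_pi_le_freq`). Therefore the nonzero modes of `b` are bounded by `(ε/π) |F̂
+ ĝ|`, which the energy estimate controls by `ε ‖G‖`. No corrector is needed for them.

In the zero mode `ξ = κ = εθ`, and the factor `ε` cancels: `iθ × E₀ = -B₀`, `iθ × B₀ = F₀ + ∫ G`.
What is missing is the effective law `F₀ ≈ M E₀` with `M` the homogenised matrix
(`norm_effective_residual_le`). It comes from a quantitative div-curl argument with the cell field
`q = ∑ v_j (∇(e_κ Ψ_j) + e_κ e_j)`. The zero mode of `q` is `v` and its other modes are parallel to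
`ξ`; `A⁻¹ q` has zero mode `M v` and its other modes are orthogonal to `ξ`. Thus `⟨v, F₀⟩ = ∫ q · F
= ∫ A⁻¹ q · E`, and the last integral is `⟨M v, E₀⟩` up to nonzero modes in which `E` is seen only
through `ξ × Ê`, of size `ε |b̂|`.

Finally `d` solves `(iθ × iθ × + M) d = ∫ G`, so `E₀ + d` solves the same equation with the residual
on the right. Coercivity of `M`, uniform in `κ`, bounds `iθ × (E₀ + d) = -(B₀ - iθ × d)` by that
residual, uniformly in `θ` (`norm_iCross_sq_le`).

Both existence statements are orthogonal projections onto closed subspaces (`exists_orthogonal`);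
for the cell problem the Poincaré inequality recovers the potential from its gradient. -/

lemma expo_add (ξ η x : R3) : expo (ξ + η) x = expo ξ x * expo η x := by
  simp only [expo, ← Complex.exp_add, ← mul_add, ← Complex.ofReal_add, ← Finset.sum_add_distrib,
    Pi.add_apply, add_mul]

lemma expo_neg (ξ x : R3) : expo (-ξ) x = (starRingEnd ℂ) (expo ξ x) := by
  simp only [expo, ← Complex.exp_conj, map_mul, Complex.conj_I, Complex.conj_ofReal,
    Pi.neg_apply, neg_mul, Finset.sum_neg_distrib, Complex.ofReal_neg, mul_neg]

@[simp] lemma norm_expo (ξ x : R3) : ‖expo ξ x‖ = 1 := by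
  rw [expo, mul_comm, Complex.norm_exp_ofReal_mul_I]

@[simp] lemma expo_ne_zero (ξ x : R3) : expo ξ x ≠ 0 := Complex.exp_ne_zero _

@[simp] lemma expo_zero (x : R3) : expo 0 x = 1 := by simp [expo]

lemma expo_neg_mul_expo (ξ x : R3) : expo (-ξ) x * expo ξ x = 1 := by
  rw [← expo_add]; simp

lemma expo_inv (ξ x : R3) : (expo ξ x)⁻¹ = expo (-ξ) x :=
  inv_eq_of_mul_eq_one_left (expo_neg_mul_expo ξ x)

lemma conj_expo_mul_self (ξ x : R3) : (starRingEnd ℂ) (expo ξ x) * expo ξ x = 1 := by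
  rw [← expo_neg, expo_neg_mul_expo]

lemma contDiff_expo (ξ : R3) : ContDiff ℝ ∞ (expo ξ) := by
  have h : ContDiff ℝ ∞ fun x : R3 => ∑ i, ξ i * x i :=
    ContDiff.sum fun i _ => contDiff_const.mul (contDiff_apply ℝ ℝ i)
  exact Complex.contDiff_exp.comp (contDiff_const.mul (Complex.ofRealCLM.contDiff.comp h))

lemma continuous_expo (ξ : R3) : Continuous (expo ξ) := (contDiff_expo ξ).continuous

lemma differentiable_expo (ξ : R3) : Differentiable ℝ (expo ξ) :=
  (contDiff_expo ξ).differentiable (by simp)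

lemma pderiv_expo (j : Fin 3) (ξ x : R3) :
    pderiv j (expo ξ) x = Complex.I * ξ j * expo ξ x := by
  have h1 : HasFDerivAt (fun x : R3 => ∑ i, ξ i * x i)
      (∑ i, ξ i • (ContinuousLinearMap.proj i : R3 →L[ℝ] ℝ)) x := by
    refine HasFDerivAt.fun_sum fun i _ => ?_
    exact ((ContinuousLinearMap.proj i : R3 →L[ℝ] ℝ).hasFDerivAt).const_mul (ξ i)
  have h2 := ((Complex.ofRealCLM.hasFDerivAt.comp x h1).const_mul Complex.I).cexp
  have h3 : fderiv ℝ (expo ξ) x = _ := h2.fderiv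
  rw [pderiv, h3]
  simp [expo, Pi.single_apply]
  ring

lemma pderiv_mul {f g : R3 → ℂ} {x : R3} (hf : DifferentiableAt ℝ f x)
    (hg : DifferentiableAt ℝ g x) (j : Fin 3) :
    pderiv j (fun y => f y * g y) x = f x * pderiv j g x + pderiv j f x * g x := by
  simp [pderiv, fderiv_fun_mul hf hg]; ring

lemma pderiv_expo_mul {f : R3 → ℂ} {x : R3} (ξ : R3) (hf : DifferentiableAt ℝ f x) (j : Fin 3) :
    pderiv j (fun y => expo ξ y * f y) x =
      expo ξ x * (pderiv j f x + Complex.I * ξ j * f x) := by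
  rw [pderiv_mul (differentiable_expo ξ x) hf, pderiv_expo]; ring

lemma SmoothPer.differentiable {E : Type*} [NormedAddCommGroup E] [NormedSpace ℝ E] {φ : R3 → E}
    (h : SmoothPer φ) : Differentiable ℝ φ := h.1.differentiable (by simp)

lemma SmoothPer.mul {f g : R3 → ℂ} (hf : SmoothPer f) (hg : SmoothPer g) :
    SmoothPer fun x => f x * g x :=
  ⟨hf.1.mul hg.1, fun n x => by simp only [hf.2 n x, hg.2 n x]⟩

lemma SmoothPer.add {E : Type*} [NormedAddCommGroup E] [NormedSpace ℝ E] {f g : R3 → E}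
    (hf : SmoothPer f) (hg : SmoothPer g) :
    SmoothPer fun x => f x + g x :=
  ⟨hf.1.add hg.1, fun n x => by simp only [hf.2 n x, hg.2 n x]⟩

lemma SmoothPer.const_smul {E : Type*} [NormedAddCommGroup E] [NormedSpace ℝ E] [NormedSpace ℂ E]
    {f : R3 → E} (hf : SmoothPer f) (c : ℂ) : SmoothPer fun x => c • f x :=
  ⟨contDiff_const.smul hf.1, fun n x => by simp only [hf.2 n x]⟩

lemma SmoothPer.zero {E : Type*} [NormedAddCommGroup E] [NormedSpace ℝ E] :
    SmoothPer fun _ : R3 => (0 : E) := ⟨contDiff_const, fun _ _ => rfl⟩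

/-- The translated dual lattice `κ + 2πℤ³`. -/
def freq (κ : R3) (n : Fin 3 → ℤ) : R3 := fun i => κ i + 2 * Real.pi * n i

lemma freq_zero (κ : R3) : freq κ 0 = κ := by ext; simp [freq]

lemma freq_eq_add (κ : R3) (n : Fin 3 → ℤ) : freq κ n = freq 0 n + κ := by
  ext; simp [freq, add_comm]

lemma smoothPer_expo (n : Fin 3 → ℤ) : SmoothPer (expo (freq 0 n)) := by
  refine ⟨contDiff_expo _, fun m x => ?_⟩
  simp only [expo, Pi.add_apply, mul_add, Finset.sum_add_distrib, Complex.ofReal_add,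
    Complex.exp_add]
  have : Complex.I * ((∑ i, freq 0 n i * (m i : ℝ) : ℝ) : ℂ)
      = ((∑ i, n i * m i : ℤ) : ℂ) * (2 * Real.pi * Complex.I) := by
    push_cast [freq]
    simp only [Fin.sum_univ_three]
    simp
    ring
  rw [this, Complex.exp_int_mul_two_pi_mul_I, mul_one]

/-! ### Integrability of continuous functions on the cell -/

lemma measurableSet_cell : MeasurableSet cell := by
  have : cell = Set.pi Set.univ fun _ : Fin 3 => Set.Ico (0 : ℝ) 1 := by ext; simp [cell]
  rw [this]; exact MeasurableSet.univ_pi fun _ => measurableSet_Ico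

variable {μ : Measure R3}

lemma Admissible.isProbabilityMeasure (hμ : Admissible μ) : IsProbabilityMeasure (onCell μ) :=
  ⟨by rw [onCell, Measure.restrict_apply_univ, hμ.mass]⟩

lemma exists_bound_cell {E : Type*} [NormedAddCommGroup E] {f : R3 → E} (hf : Continuous f) :
    ∃ C, ∀ x ∈ cell, ‖f x‖ ≤ C := by
  have hc : IsCompact (Set.pi Set.univ fun _ : Fin 3 => Set.Icc (0 : ℝ) 1) :=
    isCompact_univ_pi fun _ => isCompact_Icc
  obtain ⟨C, hC⟩ := hc.exists_bound_of_continuousOn hf.continuousOn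
  exact ⟨C, fun x hx => hC x fun i _ => ⟨(hx i).1, (hx i).2.le⟩⟩

lemma ae_mem_cell : ∀ᵐ x ∂(onCell μ), x ∈ cell := ae_restrict_mem measurableSet_cell

lemma memLp_of_continuous (hμ : Admissible μ) {E : Type*} [NormedAddCommGroup E]
    [SecondCountableTopology E] {f : R3 → E}
    (hf : Continuous f) (p : ℝ≥0∞) : MemLp f p (onCell μ) := by
  have := hμ.isProbabilityMeasure
  obtain ⟨C, hC⟩ := exists_bound_cell hf
  borelize E
  exact MemLp.of_bound hf.aestronglyMeasurable C (ae_mem_cell.mono hC)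

lemma integrable_of_continuous (hμ : Admissible μ) {E : Type*} [NormedAddCommGroup E]
    [SecondCountableTopology E] {f : R3 → E} (hf : Continuous f) : Integrable f (onCell μ) :=
  memLp_one_iff_integrable.1 (memLp_of_continuous hμ hf 1)

lemma exists_bound_periodic {E : Type*} [NormedAddCommGroup E] {f : R3 → E} (hf : Continuous f)
    (hp : IsPeriodic f) : ∃ C, ∀ x, ‖f x‖ ≤ C := by
  obtain ⟨C, hC⟩ := exists_bound_cell hf
  refine ⟨C, fun x => ?_⟩
  have h := hp (fun i => -⌊x i⌋) x
  rw [← h]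
  refine hC _ fun i => ?_
  have h1 := Int.floor_le (x i)
  have h2 := Int.lt_floor_add_one (x i)
  constructor <;> simp <;> linarith

/-- A derivative in a direction `j` with `n j ≠ 0` only multiplies the exponential by the nonzero
number `2πi n_j`, and that derivative has zero mean. -/
lemma integral_expo_eq_zero (hμ : Admissible μ) {n : Fin 3 → ℤ} (hn : n ≠ 0) :
    ∫ x, expo (freq 0 n) x ∂(onCell μ) = 0 := by
  obtain ⟨j, hj⟩ := Function.ne_iff.1 hn
  have h := hμ.grad_mean _ (smoothPer_expo n) j
  simp only [pderiv_expo, integral_const_mul] at h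
  refine (mul_eq_zero.1 h).resolve_left ?_
  simpa [freq, Real.pi_ne_zero] using hj

/-! ### Completeness of the exponentials -/

/-- The projection onto the torus. -/
def toTorus (x : R3) : UnitAddTorus (Fin 3) := fun i => (x i : UnitAddCircle)

/-- The section of `toTorus` with values in the cell. -/
def ofTorus (t : UnitAddTorus (Fin 3)) : R3 := fun i => (AddCircle.equivIco 1 0 (t i)).1

lemma continuous_toTorus : Continuous toTorus :=
  continuous_pi fun i => (AddCircle.continuous_mk' 1).comp (continuous_apply i)

lemma measurable_ofTorus : Measurable ofTorus :=
  measurable_pi_lambda _ fun i => measurable_subtype_coe.comp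
    ((AddCircle.measurableEquivIco 1 0).measurable.comp (measurable_pi_apply i))

lemma ofTorus_toTorus {x : R3} (hx : x ∈ cell) : ofTorus (toTorus x) = x := by
  ext i
  have h : x i ∈ Set.Ico (0 : ℝ) (0 + 1) := by simpa using hx i
  simp [ofTorus, toTorus, AddCircle.equivIco_coe_of_mem h]

lemma mFourier_toTorus (n : Fin 3 → ℤ) (x : R3) :
    UnitAddTorus.mFourier n (toTorus x) = expo (freq 0 n) x := by
  simp only [UnitAddTorus.mFourier, ContinuousMap.coe_mk, toTorus, fourier_coe_apply, expo,
    ← Complex.exp_sum, Complex.ofReal_sum, Finset.mul_sum]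
  congr 1
  refine Finset.sum_congr rfl fun i _ => ?_
  simp [freq]
  ring

/-- Trigonometric polynomials are uniformly dense in the continuous functions on the torus, hence
dense in `L²` of any finite measure there. The cell is identified with the torus, and the measure
and `f` are carried over. -/
lemma ae_eq_zero_of_integral_expo (hμ : Admissible μ) {f : R3 → ℂ} (hf : MemLp f 2 (onCell μ))
    (h : ∀ n, ∫ x, (starRingEnd ℂ) (expo (freq 0 n) x) * f x ∂(onCell μ) = 0) :
    f =ᵐ[onCell μ] 0 := by
  have := hμ.isProbabilityMeasure
  have hm : Measurable toTorus := continuous_toTorus.measurable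
  set τ := (onCell μ).map toTorus with hτ
  have : IsProbabilityMeasure τ := Measure.isProbabilityMeasure_map hm.aemeasurable
  have hs : (f ∘ ofTorus) ∘ toTorus =ᵐ[onCell μ] f :=
    ae_mem_cell.mono fun x hx => by simp [ofTorus_toTorus hx]
  have hmap : τ.map ofTorus = onCell μ := by
    rw [hτ, Measure.map_map measurable_ofTorus hm]
    calc (onCell μ).map (ofTorus ∘ toTorus) = (onCell μ).map id :=
          Measure.map_congr (ae_mem_cell.mono fun x hx => by simp [ofTorus_toTorus hx])
      _ = onCell μ := Measure.map_id
  have hg : MemLp (f ∘ ofTorus) 2 τ := by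
    refine MemLp.comp_of_map ?_ measurable_ofTorus.aemeasurable
    rwa [hmap]
  have hd : (Submodule.span ℂ (Set.range fun n : Fin 3 → ℤ =>
      ContinuousMap.toLp (E := ℂ) 2 τ ℂ (UnitAddTorus.mFourier n))).topologicalClosure = ⊤ := by
    simpa only [Submodule.map_span, ContinuousLinearMap.coe_coe, ← Set.range_comp,
      Function.comp_def] using
      (ContinuousMap.toLp_denseRange ℂ τ ℂ (by simp)).topologicalClosure_map_submodule
        UnitAddTorus.span_mFourier_closure_eq_top
  have h0 : hg.toLp = 0 := by
    have : hg.toLp ∈ (Submodule.span ℂ (Set.range fun n : Fin 3 → ℤ =>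
        ContinuousMap.toLp (E := ℂ) 2 τ ℂ (UnitAddTorus.mFourier n)))ᗮ := by
      rw [Submodule.mem_orthogonal]
      intro u hu
      induction hu using Submodule.span_induction with
      | mem u hu =>
        obtain ⟨n, rfl⟩ := hu
        rw [L2.inner_def]
        have e1 : ∀ᵐ t ∂τ, inner ℂ ((ContinuousMap.toLp (E := ℂ) 2 τ ℂ
            (UnitAddTorus.mFourier n)) t) ((hg.toLp : Lp ℂ 2 τ) t)
            = (starRingEnd ℂ) (UnitAddTorus.mFourier n t) * (f ∘ ofTorus) t := by
          filter_upwards [ContinuousMap.coeFn_toLp (𝕜 := ℂ) (p := 2) τ (UnitAddTorus.mFourier n),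
            hg.coeFn_toLp] with t h1 h2
          rw [h1, h2, RCLike.inner_apply, mul_comm]
        rw [integral_congr_ae e1, hτ, integral_map hm.aemeasurable]
        · rw [← h n]
          refine integral_congr_ae ?_
          filter_upwards [hs] with x hx
          rw [mFourier_toTorus]
          congr 1
        · exact ((Complex.continuous_conj.comp
            (UnitAddTorus.mFourier n).continuous).aestronglyMeasurable).mul hg.1
      | zero => simp
      | add x y _ _ hx hy => rw [inner_add_left, hx, hy, add_zero]
      | smul a x _ hx => rw [inner_smul_left, hx, mul_zero]
    rwa [Submodule.topologicalClosure_eq_top_iff.1 hd, Submodule.mem_bot] at this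
  have h1 : f ∘ ofTorus =ᵐ[τ] 0 := by
    have := hg.coeFn_toLp
    rw [h0] at this
    exact this.symm.trans (Lp.coeFn_zero _ _ _)
  exact hs.symm.trans (ae_of_ae_map hm.aemeasurable h1)

/-! ### Inner products and Fourier coefficients -/

section General

variable {E : Type*} [NormedAddCommGroup E] [InnerProductSpace ℂ E]

lemma inner_toLp {ν : Measure R3} {f g : R3 → E} (hf : MemLp f 2 ν) (hg : MemLp g 2 ν) :
    inner ℂ (hf.toLp f) (hg.toLp g) = ∫ x, inner ℂ (f x) (g x) ∂ν := by
  rw [L2.inner_def]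
  refine integral_congr_ae ?_
  filter_upwards [hf.coeFn_toLp, hg.coeFn_toLp] with x h1 h2
  rw [h1, h2]

lemma integrable_inner {ν : Measure R3} {f g : R3 → E} (hf : MemLp f 2 ν) (hg : MemLp g 2 ν) :
    Integrable (fun x => inner ℂ (f x) (g x)) ν := by
  refine (L2.integrable_inner (𝕜 := ℂ) (hf.toLp f) (hg.toLp g)).congr ?_
  filter_upwards [hf.coeFn_toLp, hg.coeFn_toLp] with x h1 h2
  rw [h1, h2]

lemma norm_toLp_sq {ν : Measure R3} {f : R3 → E} (hf : MemLp f 2 ν) :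
    ‖hf.toLp f‖ ^ 2 = ∫ x, ‖f x‖ ^ 2 ∂ν := by
  have h := congrArg Complex.re (inner_toLp hf hf)
  have h2 : ∀ x, inner ℂ (f x) (f x) = ((‖f x‖ ^ 2 : ℝ) : ℂ) := fun x => by
    rw [inner_self_eq_norm_sq_to_K]; simp
  simp only [h2, integral_complex_ofReal, Complex.ofReal_re] at h
  rw [← h, inner_self_eq_norm_sq_to_K]
  simp [← Complex.ofReal_pow]

/-- The Fourier coefficient of `f` at the frequency `ξ`. -/
def coef (μ : Measure R3) (ξ : R3) (f : R3 → E) : E := ∫ x, expo (-ξ) x • f x ∂(onCell μ)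

lemma memLp_expo_smul {f : R3 → E} {p : ℝ≥0∞} {ν : Measure R3} (ξ : R3)
    (hf : MemLp f p ν) : MemLp (fun x => expo ξ x • f x) p ν := by
  refine hf.of_le (((continuous_expo ξ).aestronglyMeasurable).smul hf.1) ?_
  exact Filter.Eventually.of_forall fun x => by simp [norm_smul]

lemma memLp_of_expo_smul {f : R3 → E} {p : ℝ≥0∞} {ν : Measure R3} (ξ : R3)
    (hf : MemLp (fun x => expo ξ x • f x) p ν) : MemLp f p ν := by
  have := memLp_expo_smul (-ξ) hf
  simpa [smul_smul, expo_neg_mul_expo] using this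

omit [InnerProductSpace ℂ E] in
lemma MemLp.integrable_two (hμ : Admissible μ) {f : R3 → E} (hf : MemLp f 2 (onCell μ)) :
    Integrable f (onCell μ) := by
  have := hμ.isProbabilityMeasure
  exact hf.integrable (by norm_num)

lemma integrable_expo_smul (hμ : Admissible μ) {f : R3 → E} (hf : MemLp f 2 (onCell μ)) (ξ : R3) :
    Integrable (fun x => expo ξ x • f x) (onCell μ) :=
  MemLp.integrable_two hμ (memLp_expo_smul ξ hf)

lemma coef_sub (hμ : Admissible μ) {f g : R3 → E} (hf : MemLp f 2 (onCell μ))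
    (hg : MemLp g 2 (onCell μ)) (ξ : R3) :
    coef μ ξ (f - g) = coef μ ξ f - coef μ ξ g := by
  simp only [coef, Pi.sub_apply, smul_sub]
  exact integral_sub (integrable_expo_smul hμ hf _) (integrable_expo_smul hμ hg _)

lemma coef_add (hμ : Admissible μ) {f g : R3 → E} (hf : MemLp f 2 (onCell μ))
    (hg : MemLp g 2 (onCell μ)) (ξ : R3) :
    coef μ ξ (f + g) = coef μ ξ f + coef μ ξ g := by
  simp only [coef, Pi.add_apply, smul_add]
  exact integral_add (integrable_expo_smul hμ hf _) (integrable_expo_smul hμ hg _)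

lemma coef_congr_ae {f g : R3 → E} (h : f =ᵐ[onCell μ] g) (ξ : R3) : coef μ ξ f = coef μ ξ g :=
  integral_congr_ae (h.mono fun x hx => by simp only [hx])

lemma coef_const_smul (c : ℂ) (f : R3 → E) (ξ : R3) : coef μ ξ (c • f) = c • coef μ ξ f := by
  simp only [coef, Pi.smul_apply, smul_comm _ c, integral_smul]

lemma coef_freq_expo_smul [CompleteSpace E] (hμ : Admissible μ) (κ : R3) (n : Fin 3 → ℤ) (c : E) :
    coef μ (freq κ n) (fun x => expo κ x • c) = if n = 0 then c else 0 := by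
  have := hμ.isProbabilityMeasure
  have h : ∀ x, expo (-freq κ n) x • expo κ x • c = expo (freq 0 (-n)) x • c := fun x => by
    rw [smul_smul, ← expo_add]
    congr 2
    ext i; simp [freq]
  simp only [coef, h, integral_smul_const]
  split_ifs with hn
  · subst hn; simp [freq_zero]
  · rw [integral_expo_eq_zero hμ (neg_ne_zero.2 hn), zero_smul]

lemma norm_coef_le (hμ : Admissible μ) {f : R3 → E} (hf : MemLp f 2 (onCell μ)) (ξ : R3) :
    ‖coef μ ξ f‖ ≤ (eLpNorm f 2 (onCell μ)).toReal := by
  have := hμ.isProbabilityMeasure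
  have h1 : ‖coef μ ξ f‖ ≤ (eLpNorm (fun x => expo (-ξ) x • f x) 1 (onCell μ)).toReal := by
    rw [eLpNorm_one_eq_lintegral_enorm]
    refine (norm_integral_le_lintegral_norm _).trans (le_of_eq ?_)
    simp only [ofReal_norm]
  refine h1.trans (ENNReal.toReal_mono hf.2.ne ?_)
  have h2 : eLpNorm (fun x => expo (-ξ) x • f x) 1 (onCell μ) = eLpNorm f 1 (onCell μ) :=
    eLpNorm_congr_norm_ae (Filter.Eventually.of_forall fun x => by simp [norm_smul])
  rw [h2]
  exact eLpNorm_le_eLpNorm_of_exponent_le (by norm_num) hf.1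

end General

lemma coef_apply (hμ : Admissible μ) {f : R3 → C3} (hf : MemLp f 2 (onCell μ)) (ξ : R3)
    (i : Fin 3) : coef μ ξ f i = coef μ ξ (fun x => f x i) := by
  have h := (EuclideanSpace.proj i : C3 →L[ℂ] ℂ).integral_comp_comm
    (integrable_expo_smul hμ hf (-ξ))
  simpa [coef] using h.symm

lemma memLp_apply {f : R3 → C3} {ν : Measure R3} (hf : MemLp f 2 ν) (i : Fin 3) :
    MemLp (fun x => f x i) 2 ν :=
  (EuclideanSpace.proj i : C3 →L[ℂ] ℂ).comp_memLp' hf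

/-- The exponentials with frequencies in `κ + 2πℤ³`, as elements of `L²`. -/
def expoLp (hμ : Admissible μ) (κ : R3) (n : Fin 3 → ℤ) : Lp ℂ 2 (onCell μ) :=
  (memLp_of_continuous hμ (continuous_expo (freq κ n)) 2).toLp

lemma inner_expoLp (hμ : Admissible μ) (κ : R3) (n : Fin 3 → ℤ) {f : R3 → ℂ}
    (hf : MemLp f 2 (onCell μ)) :
    inner ℂ (expoLp hμ κ n) hf.toLp = coef μ (freq κ n) f := by
  rw [expoLp, inner_toLp]
  simp only [RCLike.inner_apply, coef, expo_neg, smul_eq_mul, mul_comm]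

lemma orthonormal_expoLp (hμ : Admissible μ) (κ : R3) : Orthonormal ℂ (expoLp hμ κ) := by
  rw [orthonormal_iff_ite]
  intro m n
  have h := coef_freq_expo_smul hμ (freq κ n) (m - n) (1 : ℂ)
  have e : freq (freq κ n) (m - n) = freq κ m := by ext; simp [freq]; ring
  rw [e] at h
  rw [show expoLp hμ κ n = (memLp_of_continuous hμ (continuous_expo (freq κ n)) 2).toLp from rfl,
    inner_expoLp]
  simpa [sub_eq_zero] using h

lemma orthogonal_expoLp (hμ : Admissible μ) (κ : R3) :
    (Submodule.span ℂ (Set.range (expoLp hμ κ)))ᗮ = ⊥ := by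
  rw [Submodule.eq_bot_iff]
  intro f hf
  rw [Submodule.mem_orthogonal] at hf
  have hfm := Lp.memLp f
  have h0 : ∀ n, coef μ (freq κ n) f = 0 := fun n => by
    rw [← inner_expoLp hμ κ n hfm, Lp.toLp_coeFn]
    exact hf _ (Submodule.subset_span ⟨n, rfl⟩)
  -- Multiplication by `e_{-κ}` moves the frequencies `κ + 2πn` back to the lattice `2πℤ³`.
  have h1 := ae_eq_zero_of_integral_expo hμ (memLp_expo_smul (-κ) hfm) fun n => by
    rw [← h0 n]
    refine integral_congr_ae (Filter.Eventually.of_forall fun x => ?_)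
    simp only [smul_eq_mul]
    rw [← expo_neg, ← mul_assoc, ← expo_add]
    congr 2
    ext i; simp [freq]
  refine (Lp.eq_zero_iff_ae_eq_zero).2 (h1.mono fun x hx => ?_)
  simpa using hx

/-- The exponentials with frequencies in `κ + 2πℤ³` as a Hilbert basis of `L²`. -/
def expoBasis (hμ : Admissible μ) (κ : R3) :
    HilbertBasis (Fin 3 → ℤ) ℂ (Lp ℂ 2 (onCell μ)) :=
  HilbertBasis.mkOfOrthogonalEqBot (orthonormal_expoLp hμ κ) (orthogonal_expoLp hμ κ)

lemma hasSum_inner_coef_scalar (hμ : Admissible μ) (κ : R3) {f g : R3 → ℂ}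
    (hf : MemLp f 2 (onCell μ)) (hg : MemLp g 2 (onCell μ)) :
    HasSum (fun n => inner ℂ (coef μ (freq κ n) f) (coef μ (freq κ n) g))
      (∫ x, inner ℂ (f x) (g x) ∂(onCell μ)) := by
  have h := (expoBasis hμ κ).hasSum_inner_mul_inner hf.toLp hg.toLp
  rw [inner_toLp] at h
  have e : ∀ n, inner ℂ hf.toLp (expoBasis hμ κ n) * inner ℂ (expoBasis hμ κ n) hg.toLp
      = inner ℂ (coef μ (freq κ n) f) (coef μ (freq κ n) g) := fun n => by
    rw [← inner_conj_symm, expoBasis, HilbertBasis.coe_mkOfOrthogonalEqBot, inner_expoLp,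
      inner_expoLp, RCLike.inner_apply, mul_comm]
  simpa only [e] using h

lemma hasSum_inner_coef (hμ : Admissible μ) (κ : R3) {f g : R3 → C3}
    (hf : MemLp f 2 (onCell μ)) (hg : MemLp g 2 (onCell μ)) :
    HasSum (fun n => inner ℂ (coef μ (freq κ n) f) (coef μ (freq κ n) g))
      (∫ x, inner ℂ (f x) (g x) ∂(onCell μ)) := by
  have h := hasSum_sum (s := Finset.univ) fun (i : Fin 3) _ =>
    hasSum_inner_coef_scalar hμ κ (memLp_apply hf i) (memLp_apply hg i)
  rw [← integral_finsetSum _ fun i _ => integrable_inner (memLp_apply hf i) (memLp_apply hg i)]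
    at h
  simpa only [PiLp.inner_apply, coef_apply hμ hf, coef_apply hμ hg] using h

lemma hasSum_norm_coef (hμ : Admissible μ) (κ : R3) {f : R3 → C3}
    (hf : MemLp f 2 (onCell μ)) :
    HasSum (fun n => ‖coef μ (freq κ n) f‖ ^ 2) (∫ x, ‖f x‖ ^ 2 ∂(onCell μ)) := by
  have h := Complex.hasSum_re (hasSum_inner_coef hμ κ hf hf)
  rw [← inner_toLp hf hf] at h
  simp only [inner_self_eq_norm_sq_to_K] at h
  rw [← norm_toLp_sq hf]
  simpa [← Complex.ofReal_pow] using h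

/-! ### Algebra of the vector product -/

lemma iCross_eq (ξ : R3) (v : C3) : iCross ξ v =
    !₂[Complex.I * (ξ 1 * v 2 - ξ 2 * v 1), Complex.I * (ξ 2 * v 0 - ξ 0 * v 2),
      Complex.I * (ξ 0 * v 1 - ξ 1 * v 0)] := by
  ext i
  simp only [iCross, crossMatrix, LinearMap.toMatrix'_mulVec, cross_apply]
  fin_cases i <;> simp <;> ring

lemma iCross_add (ξ : R3) (v w : C3) : iCross ξ (v + w) = iCross ξ v + iCross ξ w := by
  simp [iCross, Matrix.mulVec_add]

lemma iCross_smul (ξ : R3) (c : ℂ) (v : C3) : iCross ξ (c • v) = c • iCross ξ v := by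
  simp [iCross, Matrix.mulVec_smul]

/-- The vector product with `iξ` as a continuous linear map. -/
def iCrossL (ξ : R3) : C3 →L[ℂ] C3 :=
  LinearMap.toContinuousLinearMap
    { toFun := iCross ξ
      map_add' := iCross_add ξ
      map_smul' := iCross_smul ξ }

@[simp] lemma iCrossL_apply (ξ : R3) (v : C3) : iCrossL ξ v = iCross ξ v := rfl

/-- The bilinear product of a real and a complex vector. -/
def rdot (ξ : R3) (v : C3) : ℂ := ∑ i, (ξ i : ℂ) * v i

/-- A real vector as a complex one. -/
def toC3 (ξ : R3) : C3 := WithLp.toLp 2 fun i => (ξ i : ℂ)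

lemma inner_C3 (a b : C3) : inner ℂ a b =
    b 0 * (starRingEnd ℂ) (a 0) + b 1 * (starRingEnd ℂ) (a 1) + b 2 * (starRingEnd ℂ) (a 2) := by
  simp [PiLp.inner_apply, Fin.sum_univ_three]

lemma inner_iCross (ξ : R3) (a b : C3) : inner ℂ (iCross ξ a) b = inner ℂ a (iCross ξ b) := by
  simp [inner_C3, iCross_eq]; ring

lemma rdot_iCross (ξ : R3) (v : C3) : rdot ξ (iCross ξ v) = 0 := by
  simp [rdot, iCross_eq, Fin.sum_univ_three]; ring

lemma inner_toC3 (ξ : R3) (v : C3) : inner ℂ (toC3 ξ) v = rdot ξ v := by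
  simp [rdot, inner_C3, toC3, Fin.sum_univ_three]; ring

/-- Lagrange's identity: the splitting of `a` and `b` into parts along and across `ξ`. -/
lemma sq_mul_inner (ξ : R3) (a b : C3) : ((∑ i, ξ i ^ 2 : ℝ) : ℂ) * inner ℂ a b =
    inner ℂ (iCross ξ a) (iCross ξ b) + (starRingEnd ℂ) (rdot ξ a) * rdot ξ b := by
  simp [inner_C3, iCross_eq, rdot, Fin.sum_univ_three]
  linear_combination (((ξ 1 * b 2 - ξ 2 * b 1) *
      (ξ 1 * starRingEnd ℂ (a 2) - ξ 2 * starRingEnd ℂ (a 1)) +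
    (ξ 2 * b 0 - ξ 0 * b 2) * (ξ 2 * starRingEnd ℂ (a 0) - ξ 0 * starRingEnd ℂ (a 2)) +
    (ξ 0 * b 1 - ξ 1 * b 0) * (ξ 0 * starRingEnd ℂ (a 1) - ξ 1 * starRingEnd ℂ (a 0)))) *
    Complex.I_sq

lemma norm_iCross_sq {ξ : R3} {a : C3} (h : rdot ξ a = 0) :
    ‖iCross ξ a‖ ^ 2 = (∑ i, ξ i ^ 2) * ‖a‖ ^ 2 := by
  have := sq_mul_inner ξ a a
  rw [h, mul_zero, add_zero, inner_self_eq_norm_sq_to_K, inner_self_eq_norm_sq_to_K] at this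
  have h2 : (((∑ i, ξ i ^ 2) * ‖a‖ ^ 2 : ℝ) : ℂ) = ((‖iCross ξ a‖ ^ 2 : ℝ) : ℂ) := by
    rw [Complex.ofReal_mul, Complex.ofReal_pow, Complex.ofReal_pow]; exact this
  exact (Complex.ofReal_injective h2).symm

lemma pi_mul_norm_le {ξ : R3} {a : C3} (h : rdot ξ a = 0) (hξ : Real.pi ^ 2 ≤ ∑ i, ξ i ^ 2) :
    Real.pi * ‖a‖ ≤ ‖iCross ξ a‖ := by
  refine le_of_sq_le_sq ?_ (norm_nonneg _)
  rw [norm_iCross_sq h, mul_pow]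
  gcongr

/-- A vector `a` orthogonal to `ξ` sees only the part of `b` across `ξ`, of length `|ξ × b| / |ξ|`.
This is the div-curl argument in a single mode. -/
lemma pi_mul_norm_inner_le {ξ : R3} {a b : C3} (h : rdot ξ a = 0)
    (hξ : Real.pi ^ 2 ≤ ∑ i, ξ i ^ 2) :
    Real.pi * ‖inner ℂ a b‖ ≤ ‖a‖ * ‖iCross ξ b‖ := by
  set s := ∑ i, ξ i ^ 2 with hs
  have hs0 : 0 < s := lt_of_lt_of_le (by positivity) hξ
  have h1 := congrArg norm (sq_mul_inner ξ a b)
  rw [h, map_zero, zero_mul, add_zero, norm_mul, Complex.norm_real, Real.norm_of_nonneg hs0.le]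
    at h1
  have h2 := norm_inner_le_norm (𝕜 := ℂ) (iCross ξ a) (iCross ξ b)
  have h3 : ‖iCross ξ a‖ = Real.sqrt s * ‖a‖ := by
    rw [← Real.sqrt_sq (norm_nonneg (iCross ξ a)), norm_iCross_sq h, Real.sqrt_mul hs0.le,
      Real.sqrt_sq (norm_nonneg a)]
  have h4 : Real.pi ≤ Real.sqrt s := Real.le_sqrt_of_sq_le hξ
  have h5 : 0 < Real.sqrt s := Real.sqrt_pos.2 hs0
  have h6 : Real.sqrt s * (Real.sqrt s * ‖inner ℂ a b‖)
      ≤ Real.sqrt s * (‖a‖ * ‖iCross ξ b‖) := by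
    rw [← mul_assoc, Real.mul_self_sqrt hs0.le, h1, ← mul_assoc, ← h3]
    exact h2
  exact (mul_le_mul_of_nonneg_right h4 (norm_nonneg _)).trans (le_of_mul_le_mul_left h6 h5)

/-- In a direction with `n j ≠ 0` a shift by at least `2π` acts on a number of modulus at most `π`.
This spectral gap is the source of the factor `1/π` in all estimates. -/
lemma sq_pi_le_freq {κ : R3} (hκ : κ ∈ dualCell) {n : Fin 3 → ℤ} (hn : n ≠ 0) :
    Real.pi ^ 2 ≤ ∑ i, freq κ n i ^ 2 := by
  obtain ⟨j, hj⟩ := Function.ne_iff.1 hn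
  have h1 : Real.pi ^ 2 ≤ freq κ n j ^ 2 := by
    have hπ := Real.pi_pos
    obtain ⟨ha, hb⟩ := hκ j
    rw [← sq_abs (freq κ n j)]
    refine pow_le_pow_left₀ hπ.le ?_ 2
    rcases lt_or_gt_of_ne hj with h | h
    · have : (n j : ℝ) ≤ -1 := by
        have : n j ≤ -1 := by simp at h; omega
        exact_mod_cast this
      refine le_trans ?_ (neg_le_abs _)
      simp only [freq]
      nlinarith
    · have : (1 : ℝ) ≤ n j := by
        have : 1 ≤ n j := by simp at h; omega
        exact_mod_cast this
      refine le_trans ?_ (le_abs_self _)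
      simp only [freq]
      nlinarith
  exact h1.trans (Finset.single_le_sum (f := fun i => freq κ n i ^ 2)
    (fun i _ => sq_nonneg _) (Finset.mem_univ j))

/-! ### Fourier coefficients of derivatives -/

lemma continuous_pderiv {f : R3 → ℂ} (hf : ContDiff ℝ ∞ f) (j : Fin 3) :
    Continuous (pderiv j f) :=
  (hf.continuous_fderiv (by simp)).clm_apply continuous_const

lemma contDiff_expo_mul {φ : R3 → ℂ} (hφ : SmoothPer φ) (κ : R3) :
    ContDiff ℝ ∞ fun x => expo κ x * φ x := (contDiff_expo κ).mul hφ.1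

lemma contDiff_expo_smul {w : R3 → C3} (hw : SmoothPer w) (κ : R3) :
    ContDiff ℝ ∞ fun x => expo κ x • w x := (contDiff_expo κ).smul hw.1

lemma continuous_grad {f : R3 → ℂ} (hf : ContDiff ℝ ∞ f) : Continuous (grad f) :=
  (PiLp.continuous_toLp 2 _).comp (continuous_pi fun j => continuous_pderiv hf j)

lemma contDiff_apply_C3 {u : R3 → C3} (hu : ContDiff ℝ ∞ u) (i : Fin 3) :
    ContDiff ℝ ∞ fun x => u x i := (contDiff_piLp 2).1 hu i

lemma continuous_curl {u : R3 → C3} (hu : ContDiff ℝ ∞ u) : Continuous (curl u) := by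
  refine (PiLp.continuous_toLp 2 _).comp (continuous_pi fun i => ?_)
  have h := fun i j => continuous_pderiv (contDiff_apply_C3 hu i) j
  fin_cases i <;> simp <;> exact (h _ _).sub (h _ _)

lemma SmoothPer.apply {w : R3 → C3} (hw : SmoothPer w) (i : Fin 3) : SmoothPer fun x => w x i :=
  ⟨contDiff_apply_C3 hw.1 i, fun n x => by simp only [hw.2 n x]⟩

/-- Integration by parts: since `ξ - κ` lies in `2πℤ³`, the product `e_{-ξ} e_κ φ` is periodic and
its derivative has zero mean. -/
lemma coef_pderiv (hμ : Admissible μ) (κ : R3) (n : Fin 3 → ℤ) {φ : R3 → ℂ} (hφ : SmoothPer φ)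
    (j : Fin 3) :
    coef μ (freq κ n) (pderiv j fun x => expo κ x * φ x) =
      Complex.I * freq κ n j * coef μ (freq κ n) fun x => expo κ x * φ x := by
  set ξ := freq κ n with hξ
  have hd := contDiff_expo_mul hφ κ
  have h1 := hμ.grad_mean _ ((smoothPer_expo (-n)).mul hφ) j
  have h2 : (fun x => expo (freq 0 (-n)) x * φ x)
      = fun x => expo (-ξ) x * (expo κ x * φ x) := by
    funext x
    rw [← mul_assoc, ← expo_add]
    congr 2
    ext i; simp [hξ, freq]
  have h3 : ∀ x, pderiv j (fun x => expo (-ξ) x * (expo κ x * φ x)) x =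
      expo (-ξ) x * pderiv j (fun x => expo κ x * φ x) x
        - Complex.I * ξ j * (expo (-ξ) x * (expo κ x * φ x)) := fun x => by
    rw [pderiv_expo_mul _ (hd.differentiable (by simp) x)]
    simp
    ring
  simp only [h2, h3] at h1
  rw [integral_sub, integral_const_mul, sub_eq_zero] at h1
  · exact h1
  · exact integrable_of_continuous hμ ((continuous_expo _).mul (continuous_pderiv hd j))
  · exact integrable_of_continuous hμ
      (continuous_const.mul ((continuous_expo _).mul hd.continuous))

lemma coef_grad (hμ : Admissible μ) (κ : R3) (n : Fin 3 → ℤ) {φ : R3 → ℂ} (hφ : SmoothPer φ) :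
    coef μ (freq κ n) (grad fun x => expo κ x * φ x) =
      (Complex.I * coef μ (freq κ n) fun x => expo κ x * φ x) • toC3 (freq κ n) := by
  ext j
  rw [coef_apply hμ (memLp_of_continuous hμ (continuous_grad (contDiff_expo_mul hφ κ)) 2)]
  simp only [grad, PiLp.smul_apply, toC3, smul_eq_mul]
  rw [coef_pderiv hμ κ n hφ j]
  ring

lemma coef_curl (hμ : Admissible μ) (κ : R3) (n : Fin 3 → ℤ) {w : R3 → C3} (hw : SmoothPer w) :
    coef μ (freq κ n) (curl fun x => expo κ x • w x) =
      iCross (freq κ n) (coef μ (freq κ n) fun x => expo κ x • w x) := by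
  have hd := contDiff_expo_smul hw κ
  have hm := memLp_of_continuous hμ hd.continuous 2
  have hp : ∀ i j, MemLp (pderiv j fun x => expo κ x * w x i) 2 (onCell μ) := fun i j =>
    memLp_of_continuous hμ (continuous_pderiv (contDiff_expo_mul (hw.apply i) κ) j) 2
  have h := fun i j => coef_pderiv hμ κ n (hw.apply i) j
  have hs : ∀ i j k l, (coef μ (freq κ n) fun x => pderiv j (fun x => expo κ x * w x i) x
        - pderiv l (fun x => expo κ x * w x k) x)
      = Complex.I * freq κ n j * (coef μ (freq κ n) fun x => expo κ x • w x) i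
        - Complex.I * freq κ n l * (coef μ (freq κ n) fun x => expo κ x • w x) k :=
    fun i j k l => by
      have := coef_sub hμ (hp i j) (hp k l) (freq κ n)
      rw [h, h] at this
      rw [coef_apply hμ hm, coef_apply hμ hm]
      exact this
  ext i
  rw [coef_apply hμ (memLp_of_continuous hμ (continuous_curl hd) 2), iCross_eq]
  fin_cases i
  · simpa [curl, mul_sub, mul_assoc] using hs 2 1 1 2
  · simpa [curl, mul_sub, mul_assoc] using hs 0 2 2 0
  · simpa [curl, mul_sub, mul_assoc] using hs 1 0 0 1

lemma grad_expo (ξ : R3) : grad (expo ξ) = fun x => expo ξ x • Complex.I • toC3 ξ := by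
  funext x
  ext j
  simp [grad, pderiv_expo, toC3]
  ring

lemma curl_expo_smul (ξ : R3) (v : C3) :
    (curl fun x => expo ξ x • v) = fun x => expo ξ x • iCross ξ v := by
  have h : ∀ i j x, pderiv j (fun y => expo ξ y * v i) x = Complex.I * ξ j * expo ξ x * v i :=
    fun i j x => by
      rw [pderiv_mul (differentiable_expo ξ x) (differentiableAt_const _), pderiv_expo]
      simp [pderiv]
  funext x
  ext i
  rw [iCross_eq]
  fin_cases i <;> simp [curl, h] <;> ring

/-! ### Real matrices acting on complex vectors -/

lemma act_add (M : Matrix (Fin 3) (Fin 3) ℝ) (v w : C3) : act M (v + w) = act M v + act M w := by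
  simp [act, Matrix.mulVec_add]

lemma act_smul (M : Matrix (Fin 3) (Fin 3) ℝ) (c : ℂ) (v : C3) : act M (c • v) = c • act M v := by
  simp [act, Matrix.mulVec_smul]

lemma act_sub (M : Matrix (Fin 3) (Fin 3) ℝ) (v w : C3) : act M (v - w) = act M v - act M w := by
  simp [act, Matrix.mulVec_sub]

lemma act_neg (M : Matrix (Fin 3) (Fin 3) ℝ) (v : C3) : act M (-v) = -act M v := by
  simp [act, Matrix.mulVec_neg]

lemma act_act (M N : Matrix (Fin 3) (Fin 3) ℝ) (v : C3) : act M (act N v) = act (M * N) v := by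
  have : (M * N).map Complex.ofReal = M.map Complex.ofReal * N.map Complex.ofReal :=
    Matrix.map_mul (f := Complex.ofRealHom)
  simp [act, this, Matrix.mulVec_mulVec]

lemma act_one (v : C3) : act 1 v = v := by
  have : (1 : Matrix (Fin 3) (Fin 3) ℝ).map Complex.ofReal = 1 :=
    Matrix.map_one _ Complex.ofReal_zero Complex.ofReal_one
  simp [act, this]

lemma inner_act_left {M : Matrix (Fin 3) (Fin 3) ℝ} (hM : M.IsSymm) (v w : C3) :
    inner ℂ (act M v) w = inner ℂ v (act M w) := by
  have h := fun i j => hM.apply i j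
  simp [inner_C3, act, Matrix.mulVec, dotProduct, Fin.sum_univ_three, h 1 0, h 2 0, h 2 1]
  ring

lemma continuous_act {X : Type*} [TopologicalSpace X] {M : X → Matrix (Fin 3) (Fin 3) ℝ}
    {f : X → C3} (hM : Continuous M) (hf : Continuous f) :
    Continuous fun x => act (M x) (f x) := by
  refine (PiLp.continuous_toLp 2 _).comp ?_
  exact (hM.matrix_map Complex.continuous_ofReal).matrix_mulVec
    ((PiLp.continuous_ofLp 2 _).comp hf)

lemma norm_act_le (M : Matrix (Fin 3) (Fin 3) ℝ) (v : C3) :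
    ‖act M v‖ ≤ (∑ i, ∑ j, |M i j|) * ‖v‖ := by
  have h1 : ‖act M v‖ ≤ ∑ i, ‖act M v i‖ := by
    have : act M v = ∑ i, EuclideanSpace.single i (act M v i) := by
      ext j; simp [Finset.sum_apply, Pi.single_apply]
    conv_lhs => rw [this]
    refine (norm_sum_le _ _).trans (le_of_eq ?_)
    simp
  refine h1.trans ?_
  rw [Finset.sum_mul]
  refine Finset.sum_le_sum fun i _ => ?_
  have : act M v i = ∑ j, (M i j : ℂ) * v j := rfl
  rw [this, Finset.sum_mul]
  refine (norm_sum_le _ _).trans (Finset.sum_le_sum fun j _ => ?_)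
  rw [norm_mul, Complex.norm_real, Real.norm_eq_abs]
  exact mul_le_mul_of_nonneg_left (PiLp.norm_apply_le v j) (abs_nonneg _)

lemma exists_act_bound {M : R3 → Matrix (Fin 3) (Fin 3) ℝ} (hM : Continuous M)
    (hp : IsPeriodic M) : ∃ c, 0 < c ∧ ∀ x v, ‖act (M x) v‖ ≤ c * ‖v‖ := by
  obtain ⟨C, hC⟩ := exists_bound_periodic (f := fun x => ∑ i, ∑ j, |M x i j|)
    (continuous_finsetSum _ fun i _ => continuous_finsetSum _ fun j _ =>
      (hM.matrix_elem i j).abs) (fun n x => by simp only [hp n x])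
  refine ⟨max C 1, by positivity, fun x v => (norm_act_le _ v).trans ?_⟩
  exact mul_le_mul_of_nonneg_right (((le_abs_self _).trans (hC x)).trans (le_max_left _ _))
    (norm_nonneg v)

lemma memLp_act {M : R3 → Matrix (Fin 3) (Fin 3) ℝ} (hM : Continuous M)
    (hp : IsPeriodic M) {f : R3 → C3} {ν : Measure R3} (hf : MemLp f 2 ν) :
    MemLp (fun x => act (M x) (f x)) 2 ν := by
  obtain ⟨c, hc, h⟩ := exists_act_bound hM hp
  have h1 : AEStronglyMeasurable (fun x => (x, f x)) ν :=
    aestronglyMeasurable_id.prodMk hf.1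
  have h2 : Continuous fun p : R3 × C3 => act (M p.1) p.2 :=
    continuous_act (hM.comp continuous_fst) continuous_snd
  have h3 : AEStronglyMeasurable (fun x => act (M x) (f x)) ν :=
    Continuous.comp_aestronglyMeasurable (g := fun p : R3 × C3 => act (M p.1) p.2)
      (f := fun x => (x, f x)) h2 h1
  exact hf.of_le_mul h3 (Filter.Eventually.of_forall fun x => h x (f x))

/-! ### The square root of the coefficient -/

open scoped Matrix.Norms.L2Operator in
lemma continuous_cfc_sqrt {X : Type*} [TopologicalSpace X] {M : X → Matrix (Fin 3) (Fin 3) ℝ}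
    (hM : Continuous M) (hs : ∀ x, IsSelfAdjoint (M x)) : Continuous fun x => msqrt (M x) :=
  hM.cfc_of_mem_nhdsSet (s := Set.univ) Real.sqrt Filter.univ_mem hs
    Real.continuous_sqrt.continuousOn

section Coefficient

variable {A : R3 → Matrix (Fin 3) (Fin 3) ℝ}

lemma IsCoefficient.continuous (hA : IsCoefficient A) : Continuous A :=
  continuous_pi fun i => continuous_pi fun j => (hA.differentiable i j).continuous

lemma IsCoefficient.continuous_msqrt (hA : IsCoefficient A) : Continuous fun x => msqrt (A x) :=
  continuous_cfc_sqrt hA.continuous fun x => (hA.posDef x).1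

lemma isSymm_msqrt (M : Matrix (Fin 3) (Fin 3) ℝ) : (msqrt M).IsSymm := by
  have h : IsSelfAdjoint (msqrt M) := cfc_predicate _ _
  have h2 : (msqrt M).conjTranspose = msqrt M := h
  rwa [Matrix.conjTranspose_eq_transpose_of_trivial] at h2

lemma msqrt_mul_self {M : Matrix (Fin 3) (Fin 3) ℝ} (hM : M.PosDef) :
    msqrt M * msqrt M = M := by
  have hs : IsSelfAdjoint M := hM.1
  rw [msqrt, ← cfc_mul Real.sqrt Real.sqrt M]
  conv_rhs => rw [← cfc_id ℝ M]
  refine cfc_congr fun x hx => ?_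
  rw [hM.1.spectrum_real_eq_range_eigenvalues] at hx
  obtain ⟨i, rfl⟩ := hx
  exact Real.mul_self_sqrt (hM.eigenvalues_pos i).le

lemma isUnit_det_msqrt {M : Matrix (Fin 3) (Fin 3) ℝ} (hM : M.PosDef) :
    IsUnit (msqrt M).det := by
  have h := congrArg Matrix.det (msqrt_mul_self hM)
  rw [Matrix.det_mul] at h
  refine isUnit_iff_ne_zero.2 fun h0 => hM.det_pos.ne' ?_
  rw [← h, h0, zero_mul]

/-- The inverse of the square root. -/
def isqrt (M : Matrix (Fin 3) (Fin 3) ℝ) : Matrix (Fin 3) (Fin 3) ℝ := (msqrt M)⁻¹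

lemma isqrt_mul_msqrt {M : Matrix (Fin 3) (Fin 3) ℝ} (hM : M.PosDef) :
    isqrt M * msqrt M = 1 := Matrix.nonsing_inv_mul _ (isUnit_det_msqrt hM)

lemma msqrt_mul_isqrt {M : Matrix (Fin 3) (Fin 3) ℝ} (hM : M.PosDef) :
    msqrt M * isqrt M = 1 := Matrix.mul_nonsing_inv _ (isUnit_det_msqrt hM)

lemma isqrt_mul_self {M : Matrix (Fin 3) (Fin 3) ℝ} (hM : M.PosDef) :
    isqrt M * isqrt M = M⁻¹ := by
  rw [isqrt, ← Matrix.mul_inv_rev, msqrt_mul_self hM]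

lemma isSymm_isqrt (M : Matrix (Fin 3) (Fin 3) ℝ) : (isqrt M).IsSymm := by
  rw [Matrix.IsSymm, isqrt, Matrix.transpose_nonsing_inv, isSymm_msqrt M]

lemma IsCoefficient.continuous_isqrt (hA : IsCoefficient A) :
    Continuous fun x => isqrt (A x) := by
  have hc := hA.continuous_msqrt
  simp only [isqrt, Matrix.inv_def, Ring.inverse_eq_inv']
  exact (hc.matrix_det.inv₀ fun x => (isUnit_det_msqrt (hA.posDef x)).ne_zero).smul
    hc.matrix_adjugate

lemma IsCoefficient.periodic_msqrt (hA : IsCoefficient A) :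
    IsPeriodic fun x => msqrt (A x) := fun n x => by simp only [hA.periodic n x]

lemma IsCoefficient.periodic_isqrt (hA : IsCoefficient A) :
    IsPeriodic fun x => isqrt (A x) := fun n x => by simp only [hA.periodic n x]

lemma act_msqrt_isqrt {M : Matrix (Fin 3) (Fin 3) ℝ} (hM : M.PosDef) (v : C3) :
    act (msqrt M) (act (isqrt M) v) = v := by
  rw [act_act, msqrt_mul_isqrt hM, act_one]

lemma act_isqrt_msqrt {M : Matrix (Fin 3) (Fin 3) ℝ} (hM : M.PosDef) (v : C3) :
    act (isqrt M) (act (msqrt M) v) = v := by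
  rw [act_act, isqrt_mul_msqrt hM, act_one]

lemma act_isqrt_isqrt {M : Matrix (Fin 3) (Fin 3) ℝ} (hM : M.PosDef) (v : C3) :
    act (isqrt M) (act (isqrt M) v) = act M⁻¹ v := by
  rw [act_act, isqrt_mul_self hM]

lemma IsCoefficient.memLp_act_msqrt (hA : IsCoefficient A) {f : R3 → C3} {ν : Measure R3}
    (hf : MemLp f 2 ν) : MemLp (fun x => act (msqrt (A x)) (f x)) 2 ν :=
  memLp_act hA.continuous_msqrt hA.periodic_msqrt hf

lemma IsCoefficient.memLp_act_isqrt (hA : IsCoefficient A) {f : R3 → C3} {ν : Measure R3}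
    (hf : MemLp f 2 ν) : MemLp (fun x => act (isqrt (A x)) (f x)) 2 ν :=
  memLp_act hA.continuous_isqrt hA.periodic_isqrt hf

lemma IsCoefficient.memLp_act_inv (hA : IsCoefficient A) {f : R3 → C3} {ν : Measure R3}
    (hf : MemLp f 2 ν) : MemLp (fun x => act (A x)⁻¹ (f x)) 2 ν := by
  simpa only [act_isqrt_isqrt (hA.posDef _)] using hA.memLp_act_isqrt (hA.memLp_act_isqrt hf)

lemma IsCoefficient.exists_bounds (hA : IsCoefficient A) : ∃ c, 0 < c ∧
    (∀ x v, ‖act (msqrt (A x)) v‖ ≤ c * ‖v‖) ∧ ∀ x v, ‖act (isqrt (A x)) v‖ ≤ c * ‖v‖ := by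
  obtain ⟨c, hc, h⟩ := exists_act_bound hA.continuous_msqrt hA.periodic_msqrt
  obtain ⟨d, hd, h'⟩ := exists_act_bound hA.continuous_isqrt hA.periodic_isqrt
  exact ⟨max c d, lt_max_of_lt_left hc,
    fun x v => (h x v).trans (by gcongr; exact le_max_left _ _),
    fun x v => (h' x v).trans (by gcongr; exact le_max_right _ _)⟩

end Coefficient

/-! ### The closures of pairs -/

section PairClosure

variable {E F : Type*} [NormedAddCommGroup E] [NormedAddCommGroup F]

lemma exists_seq_of_mem_pairClosure {ν : Measure R3} {S : Set ((R3 → E) × (R3 → F))}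
    {p : (R3 → E) × (R3 → F)} (hp : p ∈ pairClosure ν S) :
    ∃ q : ℕ → (R3 → E) × (R3 → F), (∀ k, q k ∈ S) ∧
      Filter.Tendsto (fun k => eLpNorm (p.1 - (q k).1) 2 ν) Filter.atTop (nhds 0) ∧
      Filter.Tendsto (fun k => eLpNorm (p.2 - (q k).2) 2 ν) Filter.atTop (nhds 0) := by
  have hd : ∀ k : ℕ, (0 : ℝ≥0∞) < ((k : ℝ≥0∞) + 1)⁻¹ := fun k => by simp
  choose q hq h1 h2 using fun k : ℕ => hp.2.2 _ (hd k)
  have ht : Filter.Tendsto (fun k : ℕ => ((k : ℝ≥0∞) + 1)⁻¹) Filter.atTop (nhds 0) := by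
    have := (Filter.tendsto_add_atTop_iff_nat 1).2 ENNReal.tendsto_inv_nat_nhds_zero
    simpa using this
  exact ⟨q, hq, tendsto_of_tendsto_of_tendsto_of_le_of_le tendsto_const_nhds ht
      (fun _ => zero_le) fun k => (h1 k).le,
    tendsto_of_tendsto_of_tendsto_of_le_of_le tendsto_const_nhds ht
      (fun _ => zero_le) fun k => (h2 k).le⟩

lemma mem_pairClosure_of_tendsto {ν : Measure R3} {S : Set ((R3 → E) × (R3 → F))}
    {p : (R3 → E) × (R3 → F)} (h1 : MemLp p.1 2 ν) (h2 : MemLp p.2 2 ν)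
    {q : ℕ → (R3 → E) × (R3 → F)} (hq : ∀ k, q k ∈ S)
    (ht1 : Filter.Tendsto (fun k => eLpNorm (p.1 - (q k).1) 2 ν) Filter.atTop (nhds 0))
    (ht2 : Filter.Tendsto (fun k => eLpNorm (p.2 - (q k).2) 2 ν) Filter.atTop (nhds 0)) :
    p ∈ pairClosure ν S := by
  refine ⟨h1, h2, fun δ hδ => ?_⟩
  obtain ⟨k, hk1, hk2⟩ := ((ht1.eventually_lt_const hδ).and (ht2.eventually_lt_const hδ)).exists
  exact ⟨q k, hq k, hk1, hk2⟩

lemma subset_pairClosure {ν : Measure R3} {S : Set ((R3 → E) × (R3 → F))}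
    {p : (R3 → E) × (R3 → F)} (h1 : MemLp p.1 2 ν) (h2 : MemLp p.2 2 ν) (hp : p ∈ S) :
    p ∈ pairClosure ν S :=
  ⟨h1, h2, fun δ hδ => ⟨p, hp, by simpa using hδ, by simpa using hδ⟩⟩

end PairClosure

lemma tendsto_coef {E : Type*} [NormedAddCommGroup E] [InnerProductSpace ℂ E]
    (hμ : Admissible μ) {f : R3 → E} (hf : MemLp f 2 (onCell μ)) {q : ℕ → R3 → E}
    (hq : ∀ k, MemLp (q k) 2 (onCell μ))
    (h : Filter.Tendsto (fun k => eLpNorm (f - q k) 2 (onCell μ)) Filter.atTop (nhds 0))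
    (ξ : R3) :
    Filter.Tendsto (fun k => coef μ ξ (q k)) Filter.atTop (nhds (coef μ ξ f)) := by
  have h1 := (ENNReal.tendsto_toReal ENNReal.zero_ne_top).comp h
  rw [tendsto_iff_norm_sub_tendsto_zero]
  refine squeeze_zero (fun _ => norm_nonneg _) (fun k => ?_) h1
  rw [norm_sub_rev, ← coef_sub hμ hf (hq k)]
  exact norm_coef_le hμ (hf.sub (hq k)) ξ

lemma eLpNorm_act_le {M : R3 → Matrix (Fin 3) (Fin 3) ℝ} {c : ℝ}
    (h : ∀ x v, ‖act (M x) v‖ ≤ c * ‖v‖) (ν : Measure R3) (f : R3 → C3) :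
    eLpNorm (fun x => act (M x) (f x)) 2 ν ≤ ENNReal.ofReal c * eLpNorm f 2 ν :=
  eLpNorm_le_mul_eLpNorm_of_ae_le_mul (Filter.Eventually.of_forall fun x => h x (f x)) 2

lemma tendsto_eLpNorm_act {M : R3 → Matrix (Fin 3) (Fin 3) ℝ} {c : ℝ}
    (h : ∀ x v, ‖act (M x) v‖ ≤ c * ‖v‖) {ν : Measure R3} {f : R3 → C3} {q : ℕ → R3 → C3}
    (hq : Filter.Tendsto (fun k => eLpNorm (f - q k) 2 ν) Filter.atTop (nhds 0)) :
    Filter.Tendsto (fun k => eLpNorm ((fun x => act (M x) (f x)) - fun x => act (M x) (q k x)) 2 ν)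
      Filter.atTop (nhds 0) := by
  have h1 := ENNReal.Tendsto.const_mul (a := ENNReal.ofReal c) hq (Or.inr ENNReal.ofReal_ne_top)
  rw [mul_zero] at h1
  refine tendsto_of_tendsto_of_tendsto_of_le_of_le tendsto_const_nhds h1
    (fun _ => zero_le) fun k => ?_
  refine le_trans (le_of_eq ?_) (eLpNorm_act_le h ν (f - q k))
  congr 1
  funext x
  simp [act_sub]

/-! ### Fourier coefficients of the elements of the Sobolev spaces -/

section Coefficient

variable {A : R3 → Matrix (Fin 3) (Fin 3) ℝ}

/-- Fourier coefficients are continuous on `L²`, so both relations pass from smooth functions to the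
closure. The second one encodes the zero mean. -/
lemma coef_of_mem_H1Zero (hμ : Admissible μ) {κ : R3} {f : R3 → ℂ} {P : R3 → C3}
    (h : (f, P) ∈ H1Zero μ κ) (n : Fin 3 → ℤ) :
    coef μ (freq κ n) P = (Complex.I * coef μ (freq κ n) f) • toC3 (freq κ n) ∧
      coef μ κ f = 0 := by
  obtain ⟨q, hq, h1, h2⟩ := exists_seq_of_mem_pairClosure h
  choose φ hφ hqe using hq
  simp only [hqe] at h1 h2
  have m1 : ∀ k, MemLp (fun x => expo κ x * φ k x) 2 (onCell μ) := fun k =>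
    memLp_of_continuous hμ (contDiff_expo_mul (hφ k).1 κ).continuous 2
  have m2 : ∀ k, MemLp (grad fun x => expo κ x * φ k x) 2 (onCell μ) := fun k =>
    memLp_of_continuous hμ (continuous_grad (contDiff_expo_mul (hφ k).1 κ)) 2
  have t1 := tendsto_coef hμ h.1 m1 h1
  have t2 := tendsto_coef hμ h.2.1 m2 h2 (freq κ n)
  constructor
  · refine tendsto_nhds_unique t2 ?_
    simp only [coef_grad hμ κ n (hφ _).1]
    exact ((t1 _).const_mul _).smul_const _
  · refine tendsto_nhds_unique (t1 κ) ?_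
    have e : ∀ k, coef μ κ (fun x => expo κ x * φ k x) = 0 := fun k => by
      rw [← (hφ k).2]
      simp only [coef, smul_eq_mul, ← mul_assoc, expo_neg_mul_expo, one_mul]
    simp only [e, tendsto_const_nhds]

lemma continuous_of_smoothPer_act (hA : IsCoefficient A) {φ : R3 → C3}
    (h : SmoothPer fun x => act (msqrt (A x)) (φ x)) : Continuous φ := by
  have := continuous_act hA.continuous_isqrt h.1.continuous
  simpa only [act_isqrt_msqrt (hA.posDef _)] using this

/-- The same passage to the limit; boundedness of `A^{1/2}` keeps the approximating sequence
convergent after multiplication by it. -/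
lemma coef_of_mem_H1Curl (hμ : Admissible μ) (hA : IsCoefficient A) {κ : R3} {f V : R3 → C3}
    (h : (f, V) ∈ H1Curl μ A κ) (n : Fin 3 → ℤ) :
    coef μ (freq κ n) V =
      iCross (freq κ n) (coef μ (freq κ n) fun x => act (msqrt (A x)) (f x)) := by
  obtain ⟨c, -, hc, -⟩ := hA.exists_bounds
  obtain ⟨q, hq, h1, h2⟩ := exists_seq_of_mem_pairClosure h
  choose φ hφ hqe using hq
  simp only [hqe] at h1 h2
  have m1 : ∀ k, MemLp (fun x => expo κ x • φ k x) 2 (onCell μ) := fun k =>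
    memLp_of_continuous hμ
      ((continuous_expo κ).smul (continuous_of_smoothPer_act hA (hφ k))) 2
  have m2 : ∀ k, MemLp (curl fun x => expo κ x • act (msqrt (A x)) (φ k x)) 2 (onCell μ) :=
    fun k => memLp_of_continuous hμ (continuous_curl (contDiff_expo_smul (hφ k) κ)) 2
  have t1 := tendsto_coef hμ (hA.memLp_act_msqrt h.1) (fun k => hA.memLp_act_msqrt (m1 k))
    (tendsto_eLpNorm_act hc h1) (freq κ n)
  have t2 := tendsto_coef hμ h.2.1 m2 h2 (freq κ n)
  refine tendsto_nhds_unique t2 ?_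
  simp only [coef_curl hμ κ n (hφ _)]
  have := ((iCrossL (freq κ n)).continuous.tendsto _).comp t1
  simp only [act_smul] at this ⊢
  exact this

lemma mem_H1Curl (hμ : Admissible μ) (hA : IsCoefficient A) (κ : R3) {w : R3 → C3}
    (hw : SmoothPer w) :
    (fun x => expo κ x • act (isqrt (A x)) (w x), curl fun x => expo κ x • w x) ∈ H1Curl μ A κ := by
  have e : ∀ x, act (msqrt (A x)) (act (isqrt (A x)) (w x)) = w x := fun x =>
    act_msqrt_isqrt (hA.posDef x) _
  refine subset_pairClosure ?_ ?_ ⟨fun x => act (isqrt (A x)) (w x), ?_, ?_⟩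
  · exact memLp_of_continuous hμ
      ((continuous_expo κ).smul (continuous_act hA.continuous_isqrt hw.1.continuous)) 2
  · exact memLp_of_continuous hμ (continuous_curl (contDiff_expo_smul hw κ)) 2
  · simpa only [e] using hw
  · simp only [e]

end Coefficient

/-! ### The norm of `L²` -/

/-- The norm of `L²(Q,dμ)`. -/
def l2 {E : Type*} [NormedAddCommGroup E] (μ : Measure R3) (f : R3 → E) : ℝ :=
  (eLpNorm f 2 (onCell μ)).toReal

section General

variable {E : Type*} [NormedAddCommGroup E]

lemma l2_nonneg (f : R3 → E) : 0 ≤ l2 μ f := ENNReal.toReal_nonneg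

lemma l2_congr_norm {F : Type*} [NormedAddCommGroup F] {f : R3 → E} {g : R3 → F}
    (h : ∀ᵐ x ∂(onCell μ), ‖f x‖ = ‖g x‖) : l2 μ f = l2 μ g := by
  rw [l2, l2, eLpNorm_congr_norm_ae h]

lemma l2_le_mul {F : Type*} [NormedAddCommGroup F] {f : R3 → E} {g : R3 → F} {c : ℝ} (hc : 0 ≤ c)
    (hg : MemLp g 2 (onCell μ)) (h : ∀ x, ‖f x‖ ≤ c * ‖g x‖) : l2 μ f ≤ c * l2 μ g := by
  have h1 := eLpNorm_le_mul_eLpNorm_of_ae_le_mul (μ := onCell μ)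
    (Filter.Eventually.of_forall h) 2
  have h2 := ENNReal.toReal_mono (ENNReal.mul_ne_top ENNReal.ofReal_ne_top hg.2.ne) h1
  rwa [ENNReal.toReal_mul, ENNReal.toReal_ofReal hc] at h2

lemma l2_add_le {f g : R3 → E} (hf : MemLp f 2 (onCell μ)) (hg : MemLp g 2 (onCell μ)) :
    l2 μ (f + g) ≤ l2 μ f + l2 μ g := by
  rw [l2, l2, l2, ← ENNReal.toReal_add hf.2.ne hg.2.ne]
  exact ENNReal.toReal_mono (ENNReal.add_ne_top.2 ⟨hf.2.ne, hg.2.ne⟩)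
    (eLpNorm_add_le hf.1 hg.1 (by norm_num))

variable [InnerProductSpace ℂ E]

lemma l2_sq {f : R3 → E} (hf : MemLp f 2 (onCell μ)) :
    l2 μ f ^ 2 = ∫ x, ‖f x‖ ^ 2 ∂(onCell μ) := by
  rw [← norm_toLp_sq hf, Lp.norm_toLp, l2]

lemma norm_integral_inner_le {f g : R3 → E} (hf : MemLp f 2 (onCell μ))
    (hg : MemLp g 2 (onCell μ)) :
    ‖∫ x, inner ℂ (f x) (g x) ∂(onCell μ)‖ ≤ l2 μ f * l2 μ g := by
  rw [← inner_toLp hf hg]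
  refine (norm_inner_le_norm _ _).trans (le_of_eq ?_)
  rw [Lp.norm_toLp, Lp.norm_toLp, l2, l2]

lemma integral_inner_self {f : R3 → E} (hf : MemLp f 2 (onCell μ)) :
    ∫ x, inner ℂ (f x) (f x) ∂(onCell μ) = ((l2 μ f ^ 2 : ℝ) : ℂ) := by
  rw [← inner_toLp hf hf, inner_self_eq_norm_sq_to_K, Lp.norm_toLp, l2]
  simp

lemma l2_expo_smul (ξ : R3) (f : R3 → E) : l2 μ (fun x => expo ξ x • f x) = l2 μ f :=
  l2_congr_norm (Filter.Eventually.of_forall fun x => by simp [norm_smul])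

lemma norm_coef_le_l2 (hμ : Admissible μ) {f : R3 → E} (hf : MemLp f 2 (onCell μ)) (ξ : R3) :
    ‖coef μ ξ f‖ ≤ l2 μ f := norm_coef_le hμ hf ξ

end General

lemma hasSum_norm_coef_l2 (hμ : Admissible μ) (κ : R3) {f : R3 → C3}
    (hf : MemLp f 2 (onCell μ)) :
    HasSum (fun n => ‖coef μ (freq κ n) f‖ ^ 2) (l2 μ f ^ 2) := by
  rw [l2_sq hf]; exact hasSum_norm_coef hμ κ hf

/-- Parseval with the zero mode set apart, as that mode has no spectral gap and is estimated by
other means. -/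
lemma l2_sq_le_of_coef_le (hμ : Admissible μ) (κ : R3) {b k : R3 → C3}
    (hb : MemLp b 2 (onCell μ)) (hk : MemLp k 2 (onCell μ)) (s : ℝ)
    (h : ∀ n ≠ 0, ‖coef μ (freq κ n) b‖ ≤ s * ‖coef μ (freq κ n) k‖) :
    l2 μ b ^ 2 ≤ ‖coef μ κ b‖ ^ 2 + s ^ 2 * l2 μ k ^ 2 := by
  have h1 := hasSum_ite_eq (0 : Fin 3 → ℤ) (‖coef μ κ b‖ ^ 2)
  refine hasSum_le (fun n => ?_) (hasSum_norm_coef_l2 hμ κ hb)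
    (h1.add ((hasSum_norm_coef_l2 hμ κ hk).mul_left (s ^ 2)))
  by_cases hn : n = 0
  · subst hn
    simp only [freq_zero, if_true]
    nlinarith [sq_nonneg (s * ‖coef μ κ k‖)]
  · simp only [hn, if_false, zero_add]
    rw [← mul_pow]
    exact pow_le_pow_left₀ (norm_nonneg _) (h n hn) 2

/-- Parseval followed by Cauchy–Schwarz over the nonzero modes. In the application `t` is a cell
flux, `e` the field `E` and `b` its curl up to the factor `-ε`. -/
lemma norm_integral_inner_sub_le (hμ : Admissible μ) (κ : R3) {t e b : R3 → C3}
    (ht : MemLp t 2 (onCell μ)) (he : MemLp e 2 (onCell μ)) (hb : MemLp b 2 (onCell μ))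
    {s : ℝ} (hs : 0 ≤ s)
    (h : ∀ n ≠ 0, ‖inner ℂ (coef μ (freq κ n) t) (coef μ (freq κ n) e)‖ ≤
      s * (‖coef μ (freq κ n) t‖ * ‖coef μ (freq κ n) b‖)) :
    ‖∫ x, inner ℂ (t x) (e x) ∂(onCell μ) - inner ℂ (coef μ κ t) (coef μ κ e)‖ ≤
      s * (l2 μ t * l2 μ b) := by
  have h1 := hasSum_ite_eq (0 : Fin 3 → ℤ) (inner ℂ (coef μ κ t) (coef μ κ e))
  have h2 := (hasSum_inner_coef hμ κ ht he).sub h1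
  obtain ⟨C, hC0, hC, hCs⟩ := Real.inner_le_Lp_mul_Lq_hasSum_of_nonneg
    Real.HolderConjugate.two_two (l2_nonneg (μ := μ) t) (l2_nonneg b)
    (f := fun n => ‖coef μ (freq κ n) t‖) (g := fun n => ‖coef μ (freq κ n) b‖)
    (fun _ => norm_nonneg _) (fun _ => norm_nonneg _)
    (by simpa using hasSum_norm_coef_l2 hμ κ ht) (by simpa using hasSum_norm_coef_l2 hμ κ hb)
  have h3 := hCs.mul_left s
  rw [← h2.tsum_eq]
  refine (tsum_of_norm_bounded h3 fun n => ?_).trans (by gcongr)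
  by_cases hn : n = 0
  · subst hn
    simp only [freq_zero, if_true, sub_self, norm_zero]
    positivity
  · simpa only [hn, if_false, sub_zero] using h n hn

lemma integral_inner_eq_of_coef (hμ : Admissible μ) (κ : R3) {t e : R3 → C3}
    (ht : MemLp t 2 (onCell μ)) (he : MemLp e 2 (onCell μ))
    (h : ∀ n ≠ 0, inner ℂ (coef μ (freq κ n) t) (coef μ (freq κ n) e) = 0) :
    ∫ x, inner ℂ (t x) (e x) ∂(onCell μ) = inner ℂ (coef μ κ t) (coef μ κ e) := by
  -- The case `s = 0`; the majorant is then irrelevant, and `t` itself takes its place.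
  have h1 := norm_integral_inner_sub_le hμ κ ht he ht le_rfl fun n hn => by simp [h n hn]
  simpa [sub_eq_zero] using h1

/-! ### Linear algebra of the effective problem -/

/-- A complex matrix acting on `ℂ³` with the Euclidean norm. -/
def mact (M : Matrix (Fin 3) (Fin 3) ℂ) (v : C3) : C3 := WithLp.toLp 2 (M.mulVec v.ofLp)

lemma isUnit_det_of_coercive {M : Matrix (Fin 3) (Fin 3) ℂ} {α : ℝ} (hα : 0 < α)
    (h : ∀ v, α * ‖v‖ ^ 2 ≤ (inner ℂ v (mact M v)).re) : IsUnit M.det := by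
  rw [isUnit_iff_ne_zero]
  intro h0
  obtain ⟨v, hv, hMv⟩ := Matrix.exists_mulVec_eq_zero_iff.2 h0
  have h1 := h (WithLp.toLp 2 v)
  have h2 : mact M (WithLp.toLp 2 v) = 0 := by simp [mact, hMv]
  rw [h2, inner_zero_right, Complex.zero_re] at h1
  have h3 : 0 < ‖(WithLp.toLp 2 v : C3)‖ := norm_pos_iff.2 fun h => hv (by simpa using h)
  have : 0 < α * ‖(WithLp.toLp 2 v : C3)‖ ^ 2 := by positivity
  linarith

lemma mact_crossMatrix_sq_add (θ : R3) (M : Matrix (Fin 3) (Fin 3) ℂ) (v : C3) :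
    mact (crossMatrix θ * crossMatrix θ + M) v = iCross θ (iCross θ v) + mact M v := by
  simp [mact, iCross, Matrix.add_mulVec, Matrix.mulVec_mulVec]

/-- The map `iθ ×` is self-adjoint for real `θ`, so its square is nonnegative and can only help
coercivity. -/
lemma re_inner_crossMatrix_sq_add (θ : R3) (M : Matrix (Fin 3) (Fin 3) ℂ) (v : C3) :
    (inner ℂ v (mact (crossMatrix θ * crossMatrix θ + M) v)).re =
      ‖iCross θ v‖ ^ 2 + (inner ℂ v (mact M v)).re := by
  rw [mact_crossMatrix_sq_add, inner_add_right, ← inner_iCross, inner_self_eq_norm_sq_to_K]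
  simp [← Complex.ofReal_pow]

lemma symbolMatrix_mul {M : Matrix (Fin 3) (Fin 3) ℂ} (hM : IsUnit M.det) (θ : R3) :
    symbolMatrix θ M * M = crossMatrix θ * crossMatrix θ + M := by
  rw [symbolMatrix, Matrix.add_mul, one_mul, Matrix.mul_assoc _ _ M, Matrix.nonsing_inv_mul _ hM,
    mul_one]

/-- The symbol times `M` is `iθ × iθ × + M`, which is coercive; so the determinant of the symbol
divides a unit. -/
lemma isUnit_det_symbolMatrix {M : Matrix (Fin 3) (Fin 3) ℂ} {α : ℝ} (hα : 0 < α)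
    (h : ∀ v, α * ‖v‖ ^ 2 ≤ (inner ℂ v (mact M v)).re) (θ : R3) :
    IsUnit (symbolMatrix θ M).det := by
  have h1 : IsUnit (crossMatrix θ * crossMatrix θ + M).det :=
    isUnit_det_of_coercive hα fun v => by
      rw [re_inner_crossMatrix_sq_add]
      nlinarith [h v, sq_nonneg ‖iCross θ v‖]
  rw [← symbolMatrix_mul (isUnit_det_of_coercive hα h), Matrix.det_mul] at h1
  exact isUnit_of_mul_isUnit_left h1

lemma crossMatrix_sq_add_dVec {M : Matrix (Fin 3) (Fin 3) ℂ} {θ : R3} (hM : IsUnit M.det)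
    (hS : IsUnit (symbolMatrix θ M).det) (G : R3 → C3) :
    mact (crossMatrix θ * crossMatrix θ + M) (dVec μ θ M G) = ∫ x, G x ∂(onCell μ) := by
  rw [← symbolMatrix_mul hM]
  simp only [mact, dVec, Matrix.mulVec_mulVec]
  rw [Matrix.mul_assoc, ← Matrix.mul_assoc M, Matrix.mul_nonsing_inv _ hM, one_mul,
    Matrix.mul_nonsing_inv _ hS, Matrix.one_mulVec]

/-- Testing the equation with `x` gives `|iθ × x|² + α|x|² ≤ |x||r|`, and `α(|x||r| - α|x|²) ≤
|r|²/4`. Bounding `x` alone would not suffice, because `θ` is unbounded as `ε → 0`. -/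
lemma norm_iCross_sq_le {M : Matrix (Fin 3) (Fin 3) ℂ} {α : ℝ} (hα : 0 < α)
    (h : ∀ v, α * ‖v‖ ^ 2 ≤ (inner ℂ v (mact M v)).re) {θ : R3} {x r : C3}
    (hx : mact (crossMatrix θ * crossMatrix θ + M) x = r) :
    α * ‖iCross θ x‖ ^ 2 ≤ ‖r‖ ^ 2 := by
  have h1 := re_inner_crossMatrix_sq_add θ M x
  rw [hx] at h1
  have h2 : (inner ℂ x r).re ≤ ‖x‖ * ‖r‖ :=
    (Complex.re_le_norm _).trans (norm_inner_le_norm _ _)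
  have h3 := h x
  have h4 : ‖iCross θ x‖ ^ 2 ≤ ‖x‖ * ‖r‖ - α * ‖x‖ ^ 2 := by linarith
  nlinarith [sq_nonneg (‖r‖ - α * ‖x‖), mul_le_mul_of_nonneg_left h4 hα.le, sq_nonneg ‖r‖,
    sq_nonneg (α * ‖x‖ - ‖r‖ / 2)]

variable {A : R3 → Matrix (Fin 3) (Fin 3) ℝ}

/-! ### The fields of the cell problem -/

lemma coef_sum_smul (hμ : Admissible μ) {f : Fin 3 → R3 → C3}
    (hf : ∀ j, MemLp (f j) 2 (onCell μ)) (v : C3) (ξ : R3) :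
    coef μ ξ (fun x => ∑ j, v j • f j x) = ∑ j, v j • coef μ ξ (f j) := by
  simp only [coef, Finset.smul_sum]
  rw [integral_finsetSum]
  · simp only [smul_comm _ (v _), integral_smul]
  · intro j _
    simp only [smul_comm _ (v _)]
    exact (integrable_expo_smul hμ (hf j) (-ξ)).smul (v j)

lemma memLp_sum_smul {f : Fin 3 → R3 → C3} (hf : ∀ j, MemLp (f j) 2 (onCell μ)) (v : C3) :
    MemLp (fun x => ∑ j, v j • f j x) 2 (onCell μ) :=
  memLp_finsetSum _ fun j _ => (hf j).const_smul (v j)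

/-- The field `∇(e_κ Ψ_j) + e_κ e_j`. -/
def cellField (κ : R3) (P : Fin 3 → R3 → C3) (j : Fin 3) (x : R3) : C3 :=
  P j x + expo κ x • EuclideanSpace.single j 1

/-- The linear combination of the fields `∇(e_κ Ψ_j) + e_κ e_j` with coefficients `v`. -/
def cellComb (κ : R3) (P : Fin 3 → R3 → C3) (v : C3) (x : R3) : C3 :=
  ∑ j, v j • cellField κ P j x

lemma act_sum_smul (M : Matrix (Fin 3) (Fin 3) ℝ) (v : C3) (f : Fin 3 → C3) :
    act M (∑ j, v j • f j) = ∑ j, v j • act M (f j) := by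
  simp [Fin.sum_univ_three, act_add, act_smul]

section Cell

variable {κ : R3} {Ψ : Fin 3 → R3 → ℂ} {P : Fin 3 → R3 → C3}

lemma memLp_expo_const (hμ : Admissible μ) (κ : R3) (v : C3) :
    MemLp (fun x => expo κ x • v) 2 (onCell μ) :=
  memLp_of_continuous hμ ((continuous_expo κ).smul continuous_const) 2

lemma IsCellSolution.memLp_cellField (hμ : Admissible μ) (h : IsCellSolution μ A κ Ψ P)
    (j : Fin 3) : MemLp (cellField κ P j) 2 (onCell μ) :=
  (h j).1.2.1.add (memLp_expo_const hμ κ _)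

lemma IsCellSolution.memLp_cellComb (hμ : Admissible μ) (h : IsCellSolution μ A κ Ψ P)
    (v : C3) : MemLp (cellComb κ P v) 2 (onCell μ) :=
  memLp_sum_smul (h.memLp_cellField hμ) v

lemma IsCellSolution.coef_cellField (hμ : Admissible μ) (h : IsCellSolution μ A κ Ψ P)
    (j : Fin 3) : coef μ κ (cellField κ P j) = EuclideanSpace.single j 1 := by
  have h1 := coef_of_mem_H1Zero hμ (h j).1 0
  rw [freq_zero] at h1
  have h2 := coef_add hμ (h j).1.2.1 (memLp_expo_const hμ κ (EuclideanSpace.single j 1)) κ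
  have h3 := coef_freq_expo_smul hμ κ 0 (EuclideanSpace.single j 1 : C3)
  rw [freq_zero, if_pos rfl] at h3
  refine h2.trans ?_
  rw [h3, h1.1, h1.2, mul_zero, zero_smul, zero_add]

lemma IsCellSolution.coef_cellComb (hμ : Admissible μ) (h : IsCellSolution μ A κ Ψ P)
    (v : C3) : coef μ κ (cellComb κ P v) = v := by
  refine (coef_sum_smul hμ (h.memLp_cellField hμ) v κ).trans ?_
  simp only [h.coef_cellField hμ]
  ext i
  simp [Pi.single_apply]

/-- Away from the zero mode the constant part `e_κ e_j` contributes nothing and only a gradient is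
left. -/
lemma IsCellSolution.exists_coef_cellComb (hμ : Admissible μ) (h : IsCellSolution μ A κ Ψ P)
    (v : C3) {n : Fin 3 → ℤ} (hn : n ≠ 0) :
    ∃ c : ℂ, coef μ (freq κ n) (cellComb κ P v) = c • toC3 (freq κ n) := by
  have h1 : ∀ j, ∃ c : ℂ, coef μ (freq κ n) (cellField κ P j) = c • toC3 (freq κ n) := fun j => by
    have h2 := coef_add hμ (h j).1.2.1 (memLp_expo_const hμ κ (EuclideanSpace.single j 1))
      (freq κ n)
    rw [coef_freq_expo_smul hμ, if_neg hn, add_zero, (coef_of_mem_H1Zero hμ (h j).1 n).1] at h2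
    exact ⟨_, h2⟩
  choose c hc using h1
  refine ⟨∑ j, v j * c j, (coef_sum_smul hμ (h.memLp_cellField hμ) v _).trans ?_⟩
  simp only [hc, Finset.sum_smul, smul_smul]

lemma smoothPerZero_expo (hμ : Admissible μ) {n : Fin 3 → ℤ} (hn : n ≠ 0) :
    SmoothPerZero μ (expo (freq 0 n)) := ⟨smoothPer_expo n, integral_expo_eq_zero hμ hn⟩

lemma expo_mul_expo_freq (κ : R3) (n : Fin 3 → ℤ) :
    (fun x => expo κ x * expo (freq 0 n) x) = expo (freq κ n) := by
  funext x
  rw [← expo_add, freq_eq_add κ n, add_comm]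

lemma integral_inner_expo (ξ : R3) (hμ : Admissible μ) {f : R3 → C3} (hf : MemLp f 2 (onCell μ))
    (v : C3) : ∫ x, inner ℂ (expo ξ x • v) (f x) ∂(onCell μ) = inner ℂ v (coef μ ξ f) := by
  rw [coef, ← integral_inner (integrable_expo_smul hμ hf (-ξ))]
  simp only [inner_smul_left, inner_smul_right, expo_neg]

/-- The test function is a single exponential, whose gradient is `iξ e_ξ`. -/
lemma rdot_coef_eq_zero (hμ : Admissible μ) {f : R3 → C3} (hf : MemLp f 2 (onCell μ))
    {n : Fin 3 → ℤ}
    (h : ∫ x, inner ℂ (grad (fun y => expo κ y * expo (freq 0 n) y) x) (f x) ∂(onCell μ) = 0) :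
    rdot (freq κ n) (coef μ (freq κ n) f) = 0 := by
  rw [expo_mul_expo_freq, grad_expo, integral_inner_expo _ hμ hf, inner_smul_left, inner_toC3]
    at h
  simpa using h

lemma act_inv_cellComb (x : R3) (v : C3) :
    act (A x)⁻¹ (cellComb κ P v x) = ∑ j, v j • act (A x)⁻¹ (cellField κ P j x) :=
  act_sum_smul _ _ _

lemma IsCellSolution.rdot_coef (hμ : Admissible μ) (hA : IsCoefficient A)
    (h : IsCellSolution μ A κ Ψ P) (v : C3) {n : Fin 3 → ℤ} (hn : n ≠ 0) :
    rdot (freq κ n) (coef μ (freq κ n) fun x => act (A x)⁻¹ (cellComb κ P v x)) = 0 := by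
  have hT : ∀ j, MemLp (fun x => act (A x)⁻¹ (cellField κ P j x)) 2 (onCell μ) := fun j =>
    hA.memLp_act_inv (h.memLp_cellField hμ j)
  have h1 : ∀ j, rdot (freq κ n) (coef μ (freq κ n) fun x => act (A x)⁻¹ (cellField κ P j x)) = 0 :=
    fun j => rdot_coef_eq_zero hμ (hT j) ((h j).2 _ (smoothPerZero_expo hμ hn))
  simp only [act_inv_cellComb]
  rw [coef_sum_smul hμ hT, ← inner_toC3, inner_sum]
  simp only [inner_smul_right, inner_toC3, h1, mul_zero, Finset.sum_const_zero]

lemma IsCellSolution.coef_eq_mact (hμ : Admissible μ) (hA : IsCoefficient A)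
    (h : IsCellSolution μ A κ Ψ P) (v : C3) :
    coef μ κ (fun x => act (A x)⁻¹ (cellComb κ P v x)) = mact (homMatrix μ A κ P) v := by
  have hT : ∀ j, MemLp (fun x => act (A x)⁻¹ (cellField κ P j x)) 2 (onCell μ) := fun j =>
    hA.memLp_act_inv (h.memLp_cellField hμ j)
  simp only [act_inv_cellComb]
  rw [coef_sum_smul hμ hT]
  ext i
  have h1 : ∀ j, (coef μ κ fun x => act (A x)⁻¹ (cellField κ P j x)) i = homMatrix μ A κ P i j :=
    fun j => by
      rw [coef_apply hμ (hT j), homMatrix, Matrix.of_apply, coef]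
      refine integral_congr_ae (Filter.Eventually.of_forall fun x => ?_)
      have : (expo κ x)⁻¹ • P j x + EuclideanSpace.single j 1
          = expo (-κ) x • cellField κ P j x := by
        rw [cellField, smul_add, smul_smul, expo_neg_mul_expo, one_smul, expo_inv]
      simp only [this, act_smul, PiLp.smul_apply]
  simp [mact, Matrix.mulVec, dotProduct, h1, mul_comm]

/-- In each nonzero mode the cell field is parallel and its flux orthogonal to the frequency, so
only the zero modes `w` and `M v` survive in Parseval. Symmetry and coercivity of `M` are read off
from this energy form. -/
lemma IsCellSolution.inner_mact (hμ : Admissible μ) (hA : IsCoefficient A)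
    (h : IsCellSolution μ A κ Ψ P) (v w : C3) :
    inner ℂ w (mact (homMatrix μ A κ P) v) =
      ∫ x, inner ℂ (cellComb κ P w x) (act (A x)⁻¹ (cellComb κ P v x)) ∂(onCell μ) := by
  rw [integral_inner_eq_of_coef hμ κ (h.memLp_cellComb hμ w)
    (hA.memLp_act_inv (h.memLp_cellComb hμ v)), h.coef_cellComb hμ, h.coef_eq_mact hμ hA]
  intro n hn
  obtain ⟨c, hc⟩ := h.exists_coef_cellComb hμ w hn
  rw [hc, inner_smul_left, inner_toC3, h.rdot_coef hμ hA v hn, mul_zero]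

lemma isSymm_inv {M : Matrix (Fin 3) (Fin 3) ℝ} (hM : M.PosDef) : (M⁻¹).IsSymm := by
  have : M.conjTranspose = M := hM.1
  rw [Matrix.conjTranspose_eq_transpose_of_trivial] at this
  rw [Matrix.IsSymm, Matrix.transpose_nonsing_inv, this]

lemma IsCellSolution.inner_mact_left (hμ : Admissible μ) (hA : IsCoefficient A)
    (h : IsCellSolution μ A κ Ψ P) (v w : C3) :
    inner ℂ (mact (homMatrix μ A κ P) w) v = inner ℂ w (mact (homMatrix μ A κ P) v) := by
  rw [← inner_conj_symm, h.inner_mact hμ hA, h.inner_mact hμ hA, ← integral_conj]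
  simp only [inner_conj_symm, inner_act_left (isSymm_inv (hA.posDef _))]

lemma IsCellSolution.re_inner_mact (hμ : Admissible μ) (hA : IsCoefficient A)
    (h : IsCellSolution μ A κ Ψ P) (v : C3) :
    (inner ℂ v (mact (homMatrix μ A κ P) v)).re =
      l2 μ (fun x => act (isqrt (A x)) (cellComb κ P v x)) ^ 2 := by
  have h1 := integral_inner_self (hA.memLp_act_isqrt (h.memLp_cellComb hμ v))
  rw [h.inner_mact hμ hA]
  simp only [inner_act_left (isSymm_isqrt _), act_isqrt_isqrt (hA.posDef _)] at h1
  rw [h1, Complex.ofReal_re]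

variable {c : ℝ}

lemma norm_act_inv_le (hA : IsCoefficient A) (hc : 0 < c)
    (h2 : ∀ x v, ‖act (isqrt (A x)) v‖ ≤ c * ‖v‖) (x : R3) (v : C3) :
    ‖act (A x)⁻¹ v‖ ≤ c ^ 2 * ‖v‖ := by
  rw [← act_isqrt_isqrt (hA.posDef x)]
  refine (h2 x _).trans ?_
  rw [pow_two, mul_assoc]
  gcongr
  exact h2 x v

lemma IsCellSolution.l2_cellComb_sq_le (hμ : Admissible μ) (hA : IsCoefficient A) (hc : 0 < c)
    (h1 : ∀ x v, ‖act (msqrt (A x)) v‖ ≤ c * ‖v‖)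
    (h : IsCellSolution μ A κ Ψ P) (v : C3) :
    (c ^ 2)⁻¹ * l2 μ (cellComb κ P v) ^ 2 ≤ (inner ℂ v (mact (homMatrix μ A κ P) v)).re := by
  have h3 : l2 μ (cellComb κ P v) ≤ c * l2 μ (fun x => act (isqrt (A x)) (cellComb κ P v x)) :=
    l2_le_mul hc.le (hA.memLp_act_isqrt (h.memLp_cellComb hμ v)) fun x => by
      conv_lhs => rw [← act_msqrt_isqrt (hA.posDef x) (cellComb κ P v x)]
      exact h1 x _
  rw [h.re_inner_mact hμ hA, inv_mul_le_iff₀ (by positivity), ← mul_pow]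
  exact pow_le_pow_left₀ (l2_nonneg _) h3 2

/-- Since `v` is a Fourier coefficient of the cell field, its length is at most the `L²` norm of
that field, which the energy controls. The constant does not depend on `κ`. -/
lemma IsCellSolution.coercive (hμ : Admissible μ) (hA : IsCoefficient A) (hc : 0 < c)
    (h1 : ∀ x v, ‖act (msqrt (A x)) v‖ ≤ c * ‖v‖)
    (h : IsCellSolution μ A κ Ψ P) (v : C3) :
    (c ^ 2)⁻¹ * ‖v‖ ^ 2 ≤ (inner ℂ v (mact (homMatrix μ A κ P) v)).re := by
  refine le_trans ?_ (h.l2_cellComb_sq_le hμ hA hc h1 v)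
  have h2 := norm_coef_le_l2 hμ (h.memLp_cellComb hμ v) κ
  rw [h.coef_cellComb hμ] at h2
  gcongr

/-- With `q` the norm of the cell field, `c⁻² q² ≤ Re ⟨v, M v⟩ ≤ |v||M v| ≤ c² q |v|`, hence `q ≤ c⁴
|v|`; multiplication by `A⁻¹` costs another `c²`. -/
lemma IsCellSolution.l2_act_inv_cellComb_le (hμ : Admissible μ) (hA : IsCoefficient A)
    (hc : 0 < c) (h1 : ∀ x v, ‖act (msqrt (A x)) v‖ ≤ c * ‖v‖)
    (h2 : ∀ x v, ‖act (isqrt (A x)) v‖ ≤ c * ‖v‖)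
    (h : IsCellSolution μ A κ Ψ P) (v : C3) :
    l2 μ (fun x => act (A x)⁻¹ (cellComb κ P v x)) ≤ c ^ 6 * ‖v‖ := by
  have hm := h.memLp_cellComb hμ v
  have h3 := h.l2_cellComb_sq_le hμ hA hc h1 v
  have h4 : (inner ℂ v (mact (homMatrix μ A κ P) v)).re ≤
      ‖v‖ * ‖mact (homMatrix μ A κ P) v‖ :=
    (Complex.re_le_norm _).trans (norm_inner_le_norm _ _)
  have h5 := norm_coef_le_l2 hμ (hA.memLp_act_inv hm) κ
  rw [h.coef_eq_mact hμ hA] at h5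
  have h6 : l2 μ (fun x => act (A x)⁻¹ (cellComb κ P v x)) ≤ c ^ 2 * l2 μ (cellComb κ P v) :=
    l2_le_mul (by positivity) hm fun x => norm_act_inv_le hA hc h2 x _
  set q := l2 μ (cellComb κ P v) with hq
  have hq0 : 0 ≤ q := l2_nonneg _
  have h7 : (c ^ 2)⁻¹ * q ^ 2 ≤ ‖v‖ * (c ^ 2 * q) :=
    h3.trans (h4.trans (by gcongr; exact h5.trans h6))
  rw [inv_mul_le_iff₀ (by positivity)] at h7
  have h8 : q ≤ c ^ 4 * ‖v‖ := by
    rcases hq0.eq_or_lt with h0 | h0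
    · rw [← h0]; positivity
    · refine le_of_mul_le_mul_right ?_ h0
      linarith
  calc _ ≤ c ^ 2 * q := h6
    _ ≤ c ^ 2 * (c ^ 4 * ‖v‖) := by gcongr
    _ = c ^ 6 * ‖v‖ := by ring

end Cell

/-! ### The fields of the Maxwell system -/

section Maxwell

variable {ε : ℝ} {θ : R3} {G D B : R3 → C3} {c : ℝ}

lemma IsMaxwellSolution.memLp_left (h : IsMaxwellSolution μ A ε θ G D B) :
    MemLp D 2 (onCell μ) := by
  obtain ⟨⟨V, hV, -⟩, -⟩ := h
  exact memLp_of_expo_smul _ hV.1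

lemma eq_neg_expo_smul (hε : 0 < ε) {κ x : R3} {v b : C3}
    (h : (ε : ℂ)⁻¹ • (expo κ x)⁻¹ • v + b = 0) : v = -(ε : ℂ) • expo κ x • b := by
  have h1 : b = -((ε : ℂ)⁻¹ • (expo κ x)⁻¹ • v) := (neg_eq_of_add_eq_zero_right h).symm
  have : (ε : ℂ) ≠ 0 := by exact_mod_cast hε.ne'
  rw [h1, smul_neg, smul_neg, neg_smul, neg_neg, smul_comm (expo κ x), smul_smul, smul_smul,
    mul_inv_cancel₀ this, one_mul, smul_smul, mul_inv_cancel₀ (expo_ne_zero _ _), one_smul]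

lemma IsMaxwellSolution.exists_curl (hε : 0 < ε) (h : IsMaxwellSolution μ A ε θ G D B) :
    ∃ V : R3 → C3, ((fun x => expo (ε • θ) x • D x, V) : (R3 → C3) × (R3 → C3)) ∈
      H1Curl μ A (ε • θ) ∧ V =ᵐ[onCell μ] -(ε : ℂ) • fun x => expo (ε • θ) x • B x := by
  obtain ⟨⟨V, hV, hB⟩, -⟩ := h
  exact ⟨V, hV, hB.mono fun x hx => eq_neg_expo_smul hε hx⟩

lemma IsMaxwellSolution.memLp_right (hε : 0 < ε) (h : IsMaxwellSolution μ A ε θ G D B) :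
    MemLp B 2 (onCell μ) := by
  obtain ⟨V, hV, hB⟩ := h.exists_curl hε
  have h1 := ((memLp_congr_ae hB).1 hV.2.1).const_smul (-(ε : ℂ))⁻¹
  have : -(ε : ℂ) ≠ 0 := neg_ne_zero.2 (by exact_mod_cast hε.ne')
  rw [smul_smul, inv_mul_cancel₀ this, one_smul] at h1
  exact memLp_of_expo_smul _ h1

lemma act_expo_smul (M : R3 → Matrix (Fin 3) (Fin 3) ℝ) (κ : R3) (f : R3 → C3) :
    (fun x => act (M x) (expo κ x • f x)) = fun x => expo κ x • act (M x) (f x) := by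
  funext x; rw [act_smul]

lemma IsMaxwellSolution.coef_right (hμ : Admissible μ) (hA : IsCoefficient A) (hε : 0 < ε)
    (h : IsMaxwellSolution μ A ε θ G D B) (n : Fin 3 → ℤ) :
    iCross (freq (ε • θ) n)
      (coef μ (freq (ε • θ) n) fun x => expo (ε • θ) x • act (msqrt (A x)) (D x)) =
    -(ε : ℂ) • coef μ (freq (ε • θ) n) fun x => expo (ε • θ) x • B x := by
  obtain ⟨V, hV, hB⟩ := h.exists_curl hε
  have h1 := coef_of_mem_H1Curl hμ hA hV n
  rw [coef_congr_ae hB, coef_const_smul, act_expo_smul] at h1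
  exact h1.symm

lemma IsMaxwellSolution.rdot_coef_right (hμ : Admissible μ) (hA : IsCoefficient A) (hε : 0 < ε)
    (h : IsMaxwellSolution μ A ε θ G D B) (n : Fin 3 → ℤ) :
    rdot (freq (ε • θ) n) (coef μ (freq (ε • θ) n) fun x => expo (ε • θ) x • B x) = 0 := by
  have h1 := congrArg (rdot (freq (ε • θ) n)) (h.coef_right hμ hA hε n)
  rw [rdot_iCross, ← inner_toC3, inner_smul_right, inner_toC3] at h1
  have : -(ε : ℂ) ≠ 0 := neg_ne_zero.2 (by exact_mod_cast hε.ne')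
  exact (mul_eq_zero.1 h1.symm).resolve_left this

lemma smoothPer_expo_smul (n : Fin 3 → ℤ) (v : C3) : SmoothPer fun x => expo (freq 0 n) x • v :=
  ⟨(smoothPer_expo n).1.smul contDiff_const, fun m x => by simp only [(smoothPer_expo n).2 m x]⟩

lemma inner_expo_smul {E : Type*} [NormedAddCommGroup E] [InnerProductSpace ℂ E] (κ x : R3)
    (a b : E) : inner ℂ (expo κ x • a) (expo κ x • b) = inner ℂ a b := by
  rw [inner_smul_left, inner_smul_right, ← mul_assoc, conj_expo_mul_self, one_mul]

/-- The second equation is tested with `e_ξ A^{-1/2} v`, whose associated curl is `e_ξ (iξ × v)`.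
The factor `A^{-1/2}` moves onto `D` and cancels the `A^{1/2}` in front of `G`. -/
lemma IsMaxwellSolution.iCross_coef_right (hμ : Admissible μ) (hA : IsCoefficient A) (hε : 0 < ε)
    (hG : MemLp G 2 (onCell μ)) (h : IsMaxwellSolution μ A ε θ G D B) (n : Fin 3 → ℤ) :
    iCross (freq (ε • θ) n) (coef μ (freq (ε • θ) n) fun x => expo (ε • θ) x • B x) =
      (ε : ℂ) • (coef μ (freq (ε • θ) n) (fun x => expo (ε • θ) x • act (isqrt (A x)) (D x)) +
        coef μ (freq (ε • θ) n) fun x => expo (ε • θ) x • G x) := by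
  set κ := ε • θ with hκ
  have hε0 : (ε : ℂ) ≠ 0 := by exact_mod_cast hε.ne'
  have mB := memLp_expo_smul κ (h.memLp_right hε)
  have mF := memLp_expo_smul κ (hA.memLp_act_isqrt h.memLp_left)
  have mG := memLp_expo_smul κ hG
  rw [← inv_smul_eq_iff₀ hε0]
  refine ext_inner_left ℂ fun v => ?_
  have h1 := h.2 _ _ (mem_H1Curl hμ hA κ (smoothPer_expo_smul n v))
  have e1 : (fun x => expo κ x • expo (freq 0 n) x • v) = fun x => expo (freq κ n) x • v := by
    funext x
    rw [smul_smul]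
    exact congrArg (· • v) (congrFun (expo_mul_expo_freq κ n) x)
  have e2 : ∀ (b : C3) (x : R3), inner ℂ (act (isqrt (A x)) (expo (freq 0 n) x • v)) b =
      inner ℂ (expo (freq κ n) x • v) (expo κ x • act (isqrt (A x)) b) := fun b x => by
    have e3 : expo (freq κ n) x • v = expo κ x • expo (freq 0 n) x • v := (congrFun e1 x).symm
    rw [e3, inner_expo_smul, inner_act_left (isSymm_isqrt _)]
  rw [e1, curl_expo_smul, integral_inner_expo _ hμ mB] at h1
  simp only [e2, act_isqrt_msqrt (hA.posDef _)] at h1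
  rw [integral_inner_expo _ hμ mF, integral_inner_expo _ hμ mG, inner_iCross] at h1
  rw [inner_smul_right, inner_add_right, ← h1]
  ring

lemma IsCurrent.rdot_coef (hμ : Admissible μ) {κ : R3} (hG : IsCurrent μ κ G) (n : Fin 3 → ℤ) :
    rdot (freq κ n) (coef μ (freq κ n) fun x => expo κ x • G x) = 0 :=
  rdot_coef_eq_zero hμ (memLp_expo_smul κ hG.1) (hG.2 _ (smoothPer_expo n))

lemma rdot_add (ξ : R3) (v w : C3) : rdot ξ (v + w) = rdot ξ v + rdot ξ w := by
  simp only [← inner_toC3, inner_add_right]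

/-- The left side of the second equation is a vector product with `iξ` and `G` is divergence free,
so the remaining term is orthogonal to `ξ` as well. -/
lemma IsMaxwellSolution.rdot_coef_isqrt (hμ : Admissible μ) (hA : IsCoefficient A) (hε : 0 < ε)
    (hG : IsCurrent μ (ε • θ) G) (h : IsMaxwellSolution μ A ε θ G D B) (n : Fin 3 → ℤ) :
    rdot (freq (ε • θ) n)
      (coef μ (freq (ε • θ) n) fun x => expo (ε • θ) x • act (isqrt (A x)) (D x)) = 0 := by
  have h1 := congrArg (rdot (freq (ε • θ) n)) (h.iCross_coef_right hμ hA hε hG.1 n)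
  rw [rdot_iCross, ← inner_toC3, inner_smul_right, inner_toC3, rdot_add, hG.rdot_coef hμ,
    add_zero] at h1
  have : (ε : ℂ) ≠ 0 := by exact_mod_cast hε.ne'
  exact (mul_eq_zero.1 h1.symm).resolve_left this

/-- The solution is its own test field, with `v = V = -ε e_κ B`; both terms on the left then have
the same sign and give `-(‖B‖² + ‖D‖²)`. -/
lemma IsMaxwellSolution.energy_le (hA : IsCoefficient A) (hε : 0 < ε) (hc : 0 < c)
    (h1 : ∀ x v, ‖act (msqrt (A x)) v‖ ≤ c * ‖v‖)
    (hG : MemLp G 2 (onCell μ)) (h : IsMaxwellSolution μ A ε θ G D B) :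
    l2 μ D ≤ c * l2 μ G ∧ l2 μ B ≤ c * l2 μ G := by
  obtain ⟨V, hV, hB⟩ := h.exists_curl hε
  have mD := h.memLp_left
  have mB := h.memLp_right hε
  have hε0 : (ε : ℂ) ≠ 0 := by exact_mod_cast hε.ne'
  have e := h.2 _ _ hV
  have e1 : ∫ x, inner ℂ (V x) (expo (ε • θ) x • B x) ∂(onCell μ)
      = -(ε : ℂ) * ((l2 μ B ^ 2 : ℝ) : ℂ) := by
    rw [← integral_inner_self mB, ← integral_const_mul]
    refine integral_congr_ae (hB.mono fun x hx => ?_)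
    simp only [hx, Pi.smul_apply, inner_smul_left, inner_smul_right, map_neg, Complex.conj_ofReal]
    linear_combination (-(ε : ℂ) * inner ℂ (B x) (B x)) * conj_expo_mul_self (ε • θ) x
  rw [e1, integral_inner_self mD, neg_mul, mul_neg, ← mul_assoc, inv_mul_cancel₀ hε0, one_mul]
    at e
  have e2 := norm_integral_inner_le mD (hA.memLp_act_msqrt hG)
  rw [← e, ← Complex.ofReal_neg, ← Complex.ofReal_sub, Complex.norm_real, Real.norm_eq_abs] at e2
  have e3 : l2 μ (fun x => act (msqrt (A x)) (G x)) ≤ c * l2 μ G :=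
    l2_le_mul hc.le hG fun x => h1 x _
  have d0 : 0 ≤ l2 μ D := l2_nonneg _
  have b0 : 0 ≤ l2 μ B := l2_nonneg _
  have e4 : l2 μ D ^ 2 + l2 μ B ^ 2 ≤ l2 μ D * (c * l2 μ G) := by
    have := (neg_le_abs _).trans (e2.trans (mul_le_mul_of_nonneg_left e3 d0))
    linarith
  have g0 : 0 ≤ c * l2 μ G := mul_nonneg hc.le (l2_nonneg _)
  have e5 : l2 μ D ≤ c * l2 μ G := by
    by_contra! hlt
    nlinarith [sq_nonneg (l2 μ B), mul_lt_mul_of_pos_left hlt (g0.trans_lt hlt)]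
  refine ⟨e5, le_of_sq_le_sq ?_ g0⟩
  nlinarith [mul_le_mul_of_nonneg_right e5 g0, sq_nonneg (l2 μ D)]

end Maxwell

/-! ### The estimate -/

section Estimate

variable {ε : ℝ} {θ : R3} {G D B : R3 → C3} {c : ℝ} {Ψ : Fin 3 → R3 → ℂ} {P : Fin 3 → R3 → C3}

lemma iCross_real_smul (ε : ℝ) (θ : R3) (v : C3) : iCross (ε • θ) v = (ε : ℂ) • iCross θ v := by
  ext i
  simp only [iCross_eq, PiLp.smul_apply]
  fin_cases i <;> simp <;> ring

/-- The effective constitutive law of the zero modes, by compensated compactness made quantitative: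
`F` is divergence free, the curl of `E` is of order `ε`, and the cell fields are oscillating test
functions. -/
lemma norm_effective_residual_le (hμ : Admissible μ) (hA : IsCoefficient A) (hε : 0 < ε)
    (hκ : ε • θ ∈ dualCell) (hc : 0 < c)
    (h1 : ∀ x v, ‖act (msqrt (A x)) v‖ ≤ c * ‖v‖) (h2 : ∀ x v, ‖act (isqrt (A x)) v‖ ≤ c * ‖v‖)
    (hG : IsCurrent μ (ε • θ) G) (hP : IsCellSolution μ A (ε • θ) Ψ P)
    (h : IsMaxwellSolution μ A ε θ G D B) :
    ‖coef μ (ε • θ) (fun x => expo (ε • θ) x • act (isqrt (A x)) (D x)) -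
      mact (homMatrix μ A (ε • θ) P)
        (coef μ (ε • θ) fun x => expo (ε • θ) x • act (msqrt (A x)) (D x))‖ ≤
      ε / Real.pi * (c ^ 7 * l2 μ G) := by
  set κ := ε • θ with hκe
  set F0 := coef μ κ (fun x => expo κ x • act (isqrt (A x)) (D x)) with hF0
  set E0 := coef μ κ (fun x => expo κ x • act (msqrt (A x)) (D x)) with hE0
  set M := homMatrix μ A κ P with hM
  have mB := memLp_expo_smul κ (h.memLp_right hε)
  have mE := memLp_expo_smul κ (hA.memLp_act_msqrt h.memLp_left)
  have mF := memLp_expo_smul κ (hA.memLp_act_isqrt h.memLp_left)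
  have key : ∀ v, ‖inner ℂ v (F0 - mact M E0)‖ ≤ ε / Real.pi * (c ^ 6 * ‖v‖ * (c * l2 μ G)) := by
    intro v
    have mQ := hP.memLp_cellComb hμ v
    have mT := hA.memLp_act_inv mQ
    -- An exact identity: the gradient modes of the cell field do not see the divergence-free `F`.
    -- Then `A⁻¹` is moved from `E` to the cell field.
    have e1 : inner ℂ v F0 = ∫ x, inner ℂ (act (A x)⁻¹ (cellComb κ P v x))
        (expo κ x • act (msqrt (A x)) (D x)) ∂(onCell μ) := by
      have e2 := integral_inner_eq_of_coef hμ κ mQ mF fun n hn => by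
        obtain ⟨a, ha⟩ := hP.exists_coef_cellComb hμ v hn
        rw [ha, inner_smul_left, inner_toC3, h.rdot_coef_isqrt hμ hA hε hG n, mul_zero]
      rw [hP.coef_cellComb hμ, ← hF0] at e2
      rw [← e2]
      refine integral_congr_ae (Filter.Eventually.of_forall fun x => ?_)
      simp only [inner_act_left (isSymm_inv (hA.posDef x)), act_smul]
      rw [← act_isqrt_isqrt (hA.posDef x), act_isqrt_msqrt (hA.posDef x)]
    -- The flux is orthogonal to each nonzero frequency, so only `ξ × Ê`, of length `ε |b̂|`,
    -- enters.
    have e3 := norm_integral_inner_sub_le hμ κ mT mE mB (s := ε / Real.pi) (by positivity)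
      fun n hn => by
        have e4 := pi_mul_norm_inner_le (hP.rdot_coef hμ hA v hn) (sq_pi_le_freq hκ hn)
          (b := coef μ (freq κ n) fun x => expo κ x • act (msqrt (A x)) (D x))
        rw [h.coef_right hμ hA hε n, norm_smul, norm_neg, Complex.norm_real,
          Real.norm_of_nonneg hε.le] at e4
        rw [div_mul_eq_mul_div, le_div_iff₀' Real.pi_pos]
        refine e4.trans (le_of_eq ?_)
        ring
    rw [← e1, hP.coef_eq_mact hμ hA, hP.inner_mact_left hμ hA, ← inner_sub_right, l2_expo_smul]
      at e3
    refine e3.trans ?_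
    gcongr
    · exact l2_nonneg _
    · exact hP.l2_act_inv_cellComb_le hμ hA hc h1 h2 v
    · exact (h.energy_le hA hε hc h1 hG.1).2
  -- Duality: the residual itself as test vector turns the bound on functionals into one on the
  -- norm.
  have h3 := key (F0 - mact M E0)
  rw [inner_self_eq_norm_sq_to_K] at h3
  simp only [RCLike.norm_ofReal, norm_pow, abs_norm] at h3
  rcases (norm_nonneg (F0 - mact M E0)).eq_or_lt with h0 | h0
  · rw [← h0]
    have := l2_nonneg (μ := μ) G
    positivity
  · refine le_of_mul_le_mul_right ?_ h0
    rw [← pow_two]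
    refine h3.trans (le_of_eq ?_)
    ring

lemma norm_coef_sub_le (hμ : Admissible μ) (hA : IsCoefficient A) (hε : 0 < ε)
    (hκ : ε • θ ∈ dualCell) (hc : 0 < c)
    (h1 : ∀ x v, ‖act (msqrt (A x)) v‖ ≤ c * ‖v‖) (h2 : ∀ x v, ‖act (isqrt (A x)) v‖ ≤ c * ‖v‖)
    (hG : IsCurrent μ (ε • θ) G) (hP : IsCellSolution μ A (ε • θ) Ψ P)
    (h : IsMaxwellSolution μ A ε θ G D B) :
    ‖coef μ (ε • θ) (fun x => expo (ε • θ) x • B x) -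
      iCross θ (dVec μ θ (homMatrix μ A (ε • θ) P) G)‖ ≤ ε / Real.pi * (c ^ 8 * l2 μ G) := by
  have hε0 : (ε : ℂ) ≠ 0 := by exact_mod_cast hε.ne'
  have hr := norm_effective_residual_le hμ hA hε hκ hc h1 h2 hG hP h
  have ha := h.coef_right hμ hA hε 0
  have hb := h.iCross_coef_right hμ hA hε hG.1 0
  rw [freq_zero, iCross_real_smul] at ha hb
  have hco := hP.coercive hμ hA hc h1
  set κ := ε • θ with hκe
  set F0 := coef μ κ (fun x => expo κ x • act (isqrt (A x)) (D x)) with hF0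
  set E0 := coef μ κ (fun x => expo κ x • act (msqrt (A x)) (D x)) with hE0
  set B0 := coef μ κ (fun x => expo κ x • B x) with hB0
  set M := homMatrix μ A κ P with hM
  have ha' : iCross θ E0 = -B0 := by
    rw [neg_smul, ← smul_neg] at ha
    exact smul_right_injective _ hε0 ha
  have hG0 : coef μ κ (fun x => expo κ x • G x) = ∫ x, G x ∂(onCell μ) := by
    simp only [coef, smul_smul, expo_neg_mul_expo, one_smul]
  have hb' : iCross θ B0 = F0 + ∫ x, G x ∂(onCell μ) := by
    rw [hG0] at hb
    exact smul_right_injective _ hε0 hb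
  have hα : 0 < (c ^ 2)⁻¹ := by positivity
  have hd := crossMatrix_sq_add_dVec (isUnit_det_of_coercive hα hco)
    (isUnit_det_symbolMatrix hα hco θ) (μ := μ) G
  set d := dVec μ θ M G with hd0
  have hneg : iCross θ (-B0) = -iCross θ B0 := (iCrossL θ).map_neg B0
  -- `E₀` satisfies the effective equation with right side `-∫ G` and `d` with `+∫ G`; hence the sum
  -- measures the error.
  have hx : mact (crossMatrix θ * crossMatrix θ + M) (E0 + d) = -(F0 - mact M E0) := by
    have : mact (crossMatrix θ * crossMatrix θ + M) (E0 + d) =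
        mact (crossMatrix θ * crossMatrix θ + M) E0
          + mact (crossMatrix θ * crossMatrix θ + M) d := by
      simp [mact, Matrix.mulVec_add]
    rw [this, hd, mact_crossMatrix_sq_add, ha', hneg, hb']
    abel
  have hn := norm_iCross_sq_le hα hco hx
  rw [norm_neg, inv_mul_le_iff₀ (by positivity), ← mul_pow] at hn
  have hn' := le_of_sq_le_sq hn (by positivity)
  have hdiff : B0 - iCross θ d = -iCross θ (E0 + d) := by
    rw [iCross_add, ha']; abel
  rw [hdiff, norm_neg]
  calc _ ≤ c * ‖F0 - mact M E0‖ := hn'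
    _ ≤ c * (ε / Real.pi * (c ^ 7 * l2 μ G)) := by gcongr
    _ = _ := by ring

lemma l2_sub_iCross_dVec_le (hμ : Admissible μ) (hA : IsCoefficient A) (hε : 0 < ε)
    (hκ : ε • θ ∈ dualCell) (hc : 0 < c)
    (h1 : ∀ x v, ‖act (msqrt (A x)) v‖ ≤ c * ‖v‖) (h2 : ∀ x v, ‖act (isqrt (A x)) v‖ ≤ c * ‖v‖)
    (hG : IsCurrent μ (ε • θ) G) (hP : IsCellSolution μ A (ε • θ) Ψ P)
    (h : IsMaxwellSolution μ A ε θ G D B) :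
    l2 μ (fun x => B x - iCross θ (dVec μ θ (homMatrix μ A (ε • θ) P) G)) ≤
      (c ^ 8 + c ^ 2 + 1) / Real.pi * ε * l2 μ G := by
  have h3 := norm_coef_sub_le hμ hA hε hκ hc h1 h2 hG hP h
  set κ := ε • θ with hκe
  set b0 := iCross θ (dVec μ θ (homMatrix μ A κ P) G) with hb0
  have mB := memLp_expo_smul κ (h.memLp_right hε)
  have mF := memLp_expo_smul κ (hA.memLp_act_isqrt h.memLp_left)
  have mG := memLp_expo_smul κ hG.1
  have mb := memLp_expo_const hμ κ b0
  have e : (fun x => expo κ x • (B x - b0)) =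
      (fun x => expo κ x • B x) - fun x => expo κ x • b0 := by
    funext x; simp [smul_sub]
  -- Subtracting `e_κ b0` changes the zero mode only; in the others `b̂ ⟂ ξ` gives `π |b̂| ≤ |ξ ×
  -- b̂| = ε |F̂ + ĝ|`.
  have h4 := l2_sq_le_of_coef_le hμ κ (mB.sub mb) (mF.add mG) (ε / Real.pi) fun n hn => by
    rw [coef_sub hμ mB mb, coef_freq_expo_smul hμ, if_neg hn, sub_zero, coef_add hμ mF mG]
    have h5 := pi_mul_norm_le (h.rdot_coef_right hμ hA hε n) (sq_pi_le_freq hκ hn)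
    rw [h.iCross_coef_right hμ hA hε hG.1 n, norm_smul, Complex.norm_real,
      Real.norm_of_nonneg hε.le] at h5
    rwa [div_mul_eq_mul_div, le_div_iff₀' Real.pi_pos]
  have hcoef := coef_freq_expo_smul hμ κ 0 b0
  rw [freq_zero, if_pos rfl] at hcoef
  rw [coef_sub hμ mB mb, hcoef, ← e, l2_expo_smul] at h4
  have hF : l2 μ (fun x => act (isqrt (A x)) (D x)) ≤ c * (c * l2 μ G) :=
    (l2_le_mul hc.le h.memLp_left fun x => h2 x _).trans
      (by gcongr; exact (h.energy_le hA hε hc h1 hG.1).1)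
  have h6 := l2_add_le mF mG
  rw [l2_expo_smul, l2_expo_smul] at h6
  set g := l2 μ G with hg
  have g0 : 0 ≤ g := l2_nonneg _
  have hs : 0 ≤ ε / Real.pi := by have := Real.pi_pos; positivity
  set s := ε / Real.pi with hse
  have h7 : l2 μ ((fun x => expo κ x • act (isqrt (A x)) (D x)) + fun x => expo κ x • G x) ≤
      (c ^ 2 + 1) * g := by
    refine h6.trans ?_
    linarith
  have h8 : l2 μ (fun x => B x - b0) ≤ s * (c ^ 8 * g) + s * ((c ^ 2 + 1) * g) := by
    refine le_of_sq_le_sq (h4.trans ?_) (by positivity)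
    have h9 := pow_le_pow_left₀ (norm_nonneg _) h3 2
    have h10 := mul_le_mul_of_nonneg_left (pow_le_pow_left₀ (l2_nonneg _) h7 2) (sq_nonneg s)
    -- The cross term that makes a sum of two squares at most the square of the sum.
    have h11 : 0 ≤ s * (c ^ 8 * g) * (s * ((c ^ 2 + 1) * g)) := by positivity
    nlinarith
  refine h8.trans (le_of_eq ?_)
  rw [hse]
  ring

lemma eLpNorm_sub_iCross_dVec_le (hμ : Admissible μ) (hA : IsCoefficient A) (hε : 0 < ε)
    (hκ : ε • θ ∈ dualCell) (hc : 0 < c)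
    (h1 : ∀ x v, ‖act (msqrt (A x)) v‖ ≤ c * ‖v‖) (h2 : ∀ x v, ‖act (isqrt (A x)) v‖ ≤ c * ‖v‖)
    (hG : IsCurrent μ (ε • θ) G) (hP : IsCellSolution μ A (ε • θ) Ψ P)
    (h : IsMaxwellSolution μ A ε θ G D B) :
    eLpNorm (fun x => B x - iCross θ (dVec μ θ (homMatrix μ A (ε • θ) P) G)) 2 (onCell μ) ≤
      ENNReal.ofReal ((c ^ 8 + c ^ 2 + 1) / Real.pi * ε) * eLpNorm G 2 (onCell μ) := by
  have := hμ.isProbabilityMeasure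
  have hm : MemLp (fun x => B x - iCross θ (dVec μ θ (homMatrix μ A (ε • θ) P) G)) 2 (onCell μ) :=
    (h.memLp_right hε).sub (memLp_const _)
  have hC : 0 ≤ (c ^ 8 + c ^ 2 + 1) / Real.pi * ε := by
    have := Real.pi_pos
    positivity
  rw [← ENNReal.ofReal_toReal hm.2.ne, ← ENNReal.ofReal_toReal hG.1.2.ne,
    ← ENNReal.ofReal_mul hC]
  exact ENNReal.ofReal_le_ofReal (l2_sub_iCross_dVec_le hμ hA hε hκ hc h1 h2 hG hP h)

end Estimate

/-! ### Linearity of the differential operators -/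

lemma pderiv_add {f g : R3 → ℂ} {x : R3} (hf : DifferentiableAt ℝ f x)
    (hg : DifferentiableAt ℝ g x) (j : Fin 3) :
    pderiv j (fun y => f y + g y) x = pderiv j f x + pderiv j g x := by
  simp [pderiv, fderiv_fun_add hf hg]

lemma pderiv_const_mul {f : R3 → ℂ} {x : R3} (hf : DifferentiableAt ℝ f x) (c : ℂ) (j : Fin 3) :
    pderiv j (fun y => c * f y) x = c * pderiv j f x := by
  simp [pderiv, fderiv_const_mul hf c]

/-- The operator `φ ↦ ∇(e_κ φ)` on smooth periodic functions is additive. -/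
lemma grad_expo_add (κ : R3) {φ ψ : R3 → ℂ} (hφ : SmoothPer φ) (hψ : SmoothPer ψ) :
    (grad fun x => expo κ x * (φ x + ψ x)) =
      (grad fun x => expo κ x * φ x) + grad fun x => expo κ x * ψ x := by
  funext x
  ext j
  simp only [grad, Pi.add_apply, PiLp.add_apply, mul_add]
  exact pderiv_add ((contDiff_expo_mul hφ κ).differentiable (by simp) x)
    ((contDiff_expo_mul hψ κ).differentiable (by simp) x) j

lemma grad_expo_smul (κ : R3) (c : ℂ) {φ : R3 → ℂ} (hφ : SmoothPer φ) :
    (grad fun x => expo κ x * (c * φ x)) = c • grad fun x => expo κ x * φ x := by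
  funext x
  ext j
  simp only [grad, Pi.smul_apply, PiLp.smul_apply, mul_left_comm _ c]
  exact pderiv_const_mul ((contDiff_expo_mul hφ κ).differentiable (by simp) x) c j

lemma differentiable_expo_mul_apply {w : R3 → C3} (hw : SmoothPer w) (κ : R3) (i : Fin 3)
    (x : R3) : DifferentiableAt ℝ (fun x => expo κ x * w x i) x :=
  (contDiff_expo_mul (hw.apply i) κ).differentiable (by simp) x

lemma curl_expo_add (κ : R3) {w z : R3 → C3} (hw : SmoothPer w) (hz : SmoothPer z) :
    (curl fun x => expo κ x • (w x + z x)) =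
      (curl fun x => expo κ x • w x) + curl fun x => expo κ x • z x := by
  have h : ∀ i j x, pderiv j (fun y => expo κ y * w y i + expo κ y * z y i) x =
      pderiv j (fun y => expo κ y * w y i) x + pderiv j (fun y => expo κ y * z y i) x :=
    fun i j x => pderiv_add (differentiable_expo_mul_apply hw κ i x)
      (differentiable_expo_mul_apply hz κ i x) j
  funext x
  ext i
  fin_cases i <;> simp [curl, h] <;> ring

lemma curl_expo_const_smul (κ : R3) (c : ℂ) {w : R3 → C3} (hw : SmoothPer w) :
    (curl fun x => expo κ x • (c • w x)) = c • curl fun x => expo κ x • w x := by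
  have h : ∀ i j x, pderiv j (fun y => expo κ y * (c * w y i)) x =
      c * pderiv j (fun y => expo κ y * w y i) x :=
    fun i j x => by
      simp only [mul_left_comm _ c]
      exact pderiv_const_mul (differentiable_expo_mul_apply hw κ i x) c j
  funext x
  ext i
  fin_cases i <;> simp [curl, h] <;> ring

/-! ### Linear maps into `L²` -/

/-- A linear map with values in square integrable functions, as a map into `L²`. -/
def toLpLin {X E : Type*} [AddCommGroup X] [Module ℂ X] [NormedAddCommGroup E]
    [InnerProductSpace ℂ E] (ν : Measure R3) (L : X →ₗ[ℂ] (R3 → E))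
    (h : ∀ x, MemLp (L x) 2 ν) : X →ₗ[ℂ] Lp E 2 ν where
  toFun x := (h x).toLp (L x)
  map_add' x y := by
    rw [← MemLp.toLp_add]
    exact MemLp.toLp_congr _ _ (Filter.Eventually.of_forall fun t => by rw [map_add])
  map_smul' c x := by
    rw [RingHom.id_apply, ← MemLp.toLp_const_smul]
    exact MemLp.toLp_congr _ _ (Filter.Eventually.of_forall fun t => by rw [map_smul])

lemma tendsto_toLp_iff {E : Type*} [NormedAddCommGroup E] {ν : Measure R3} {f : R3 → E}
    (hf : MemLp f 2 ν) {q : ℕ → R3 → E} (hq : ∀ k, MemLp (q k) 2 ν) :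
    Filter.Tendsto (fun k => (hq k).toLp (q k)) Filter.atTop (nhds (hf.toLp f)) ↔
      Filter.Tendsto (fun k => eLpNorm (f - q k) 2 ν) Filter.atTop (nhds 0) := by
  rw [Lp.tendsto_Lp_iff_tendsto_eLpNorm'' _ hq _ hf]
  simp only [eLpNorm_sub_comm (q _) f]

/-- Both weak problems have the form "unknown minus data is orthogonal to a closed subspace
containing the unknown", which the orthogonal projection solves. -/
lemma exists_orthogonal {H : Type*} [NormedAddCommGroup H] [InnerProductSpace ℂ H]
    [CompleteSpace H] (K : Submodule ℂ H) (g : H) :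
    ∃ u ∈ K.topologicalClosure, ∀ s ∈ K.topologicalClosure, inner ℂ s (g - u) = 0 := by
  have : CompleteSpace K.topologicalClosure :=
    K.isClosed_topologicalClosure.completeSpace_coe
  exact ⟨K.topologicalClosure.starProjection g, Submodule.starProjection_apply_mem _ _,
    fun s hs => (Submodule.mem_orthogonal _ _).1
      (Submodule.sub_starProjection_mem_orthogonal g) s hs⟩

/-! ### Solvability of the cell problem -/

/-- The smooth periodic functions of zero mean. -/
def smoothPerZeroSub (hμ : Admissible μ) : Submodule ℂ (R3 → ℂ) where
  carrier := {φ | SmoothPerZero μ φ}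
  add_mem' {f g} hf hg := ⟨hf.1.add hg.1, by
    have := integral_add (integrable_of_continuous hμ hf.1.1.continuous)
      (integrable_of_continuous hμ hg.1.1.continuous)
    simp only [Pi.add_apply]
    rw [this, hf.2, hg.2, add_zero]⟩
  zero_mem' := ⟨SmoothPer.zero, by simp⟩
  smul_mem' c f hf := ⟨hf.1.const_smul c, by
    simp only [Pi.smul_apply]
    rw [integral_smul, hf.2, smul_zero]⟩

/-- The map `φ ↦ A^{-1/2} ∇(e_κ φ)`. -/
def cellMap (hμ : Admissible μ) (A : R3 → Matrix (Fin 3) (Fin 3) ℝ) (κ : R3) :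
    smoothPerZeroSub hμ →ₗ[ℂ] (R3 → C3) where
  toFun φ x := act (isqrt (A x)) (grad (fun y => expo κ y * φ.1 y) x)
  map_add' φ ψ := by
    funext x
    have := congrFun (grad_expo_add κ φ.2.1 ψ.2.1) x
    simp only [Pi.add_apply, Submodule.coe_add] at this ⊢
    rw [this, act_add]
  map_smul' c φ := by
    funext x
    have := congrFun (grad_expo_smul κ c φ.2.1) x
    simp only [Pi.smul_apply, RingHom.id_apply, Submodule.coe_smul, smul_eq_mul] at this ⊢
    rw [this, act_smul]

lemma memLp_grad (hμ : Admissible μ) (κ : R3) {φ : R3 → ℂ} (hφ : SmoothPer φ) :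
    MemLp (grad fun x => expo κ x * φ x) 2 (onCell μ) :=
  memLp_of_continuous hμ (continuous_grad (contDiff_expo_mul hφ κ)) 2

lemma memLp_expo_mul (hμ : Admissible μ) (κ : R3) {φ : R3 → ℂ} (hφ : SmoothPer φ) :
    MemLp (fun x => expo κ x * φ x) 2 (onCell μ) :=
  memLp_of_continuous hμ (contDiff_expo_mul hφ κ).continuous 2

lemma norm_toC3_sq (ξ : R3) : ‖toC3 ξ‖ ^ 2 = ∑ i, ξ i ^ 2 := by
  simp [EuclideanSpace.norm_sq_eq, toC3]

/-- The Poincaré inequality for smooth functions of zero mean. -/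
lemma poincare (hμ : Admissible μ) {κ : R3} (hκ : κ ∈ dualCell) {φ : R3 → ℂ}
    (hφ : SmoothPerZero μ φ) :
    Real.pi * l2 μ (fun x => expo κ x * φ x) ≤ l2 μ (grad fun x => expo κ x * φ x) := by
  have m1 := memLp_expo_mul hμ κ hφ.1
  refine le_of_sq_le_sq ?_ (l2_nonneg _)
  rw [mul_pow]
  have h1 := hasSum_inner_coef_scalar hμ κ m1 m1
  rw [integral_inner_self m1] at h1
  simp only [inner_self_eq_norm_sq_to_K] at h1
  have h2 := (Complex.hasSum_re h1).mul_left (Real.pi ^ 2)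
  rw [Complex.ofReal_re] at h2
  refine hasSum_le (fun n => ?_) h2 (hasSum_norm_coef_l2 hμ κ (memLp_grad hμ κ hφ.1))
  rw [coef_grad hμ κ n hφ.1, norm_smul, norm_mul, Complex.norm_I, one_mul, mul_pow, norm_toC3_sq]
  have h3 : (((‖coef μ (freq κ n) fun x => expo κ x * φ x‖ : ℝ) : ℂ) ^ 2).re =
      ‖coef μ (freq κ n) fun x => expo κ x * φ x‖ ^ 2 := by
    rw [← Complex.ofReal_pow, Complex.ofReal_re]
  refine (congrArg (Real.pi ^ 2 * ·) h3).trans_le ?_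
  by_cases hn : n = 0
  · have : (coef μ (freq κ n) fun x => expo κ x * φ x) = 0 := by
      rw [hn, freq_zero, ← hφ.2]
      simp only [coef, smul_eq_mul, ← mul_assoc, expo_neg_mul_expo, one_mul]
    simp [this]
  · rw [mul_comm]
    gcongr
    exact sq_pi_le_freq hκ hn

/-- By the Poincaré inequality for differences, convergent gradients have Cauchy potentials; their
limit is the potential of `P`. -/
lemma exists_scalar_limit (hμ : Admissible μ) {κ : R3} (hκ : κ ∈ dualCell) {P : R3 → C3}
    (hP : MemLp P 2 (onCell μ)) {φ : ℕ → R3 → ℂ} (hφ : ∀ k, SmoothPerZero μ (φ k))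
    (h : Filter.Tendsto (fun k => eLpNorm (P - grad fun x => expo κ x * φ k x) 2 (onCell μ))
      Filter.atTop (nhds 0)) :
    ∃ Ψ : R3 → ℂ, (fun x => expo κ x * Ψ x, P) ∈ H1Zero μ κ := by
  have m1 := fun k => memLp_expo_mul hμ κ (hφ k).1
  have m2 := fun k => memLp_grad hμ κ (hφ k).1
  have hc := ((tendsto_toLp_iff hP m2).2 h).cauchySeq
  have hd : ∀ k l, dist ((m1 k).toLp) ((m1 l).toLp) ≤
      Real.pi⁻¹ * dist ((m2 k).toLp) ((m2 l).toLp) := fun k l => by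
    rw [dist_eq_norm, dist_eq_norm, ← MemLp.toLp_sub, ← MemLp.toLp_sub, Lp.norm_toLp,
      Lp.norm_toLp]
    have hs : SmoothPerZero μ (φ k + (-1 : ℂ) • φ l) :=
      (smoothPerZeroSub hμ).add_mem (hφ k) ((smoothPerZeroSub hμ).smul_mem (-1) (hφ l))
    have h1 := poincare hμ hκ hs
    have e1 : (fun x => expo κ x * (φ k + (-1 : ℂ) • φ l) x) =
        (fun x => expo κ x * φ k x) - fun x => expo κ x * φ l x := by
      funext x; simp; ring
    have e2 : (grad fun x => expo κ x * (φ k + (-1 : ℂ) • φ l) x) =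
        (grad fun x => expo κ x * φ k x) - grad fun x => expo κ x * φ l x := by
      have := grad_expo_add κ (hφ k).1 ((hφ l).1.const_smul (-1))
      simp only [smul_eq_mul] at this
      rw [grad_expo_smul κ (-1) (hφ l).1] at this
      simpa [sub_eq_add_neg] using this
    rw [e2, e1] at h1
    rw [← div_eq_inv_mul, le_div_iff₀' Real.pi_pos]
    exact h1
  have hc1 : CauchySeq fun k => (m1 k).toLp := by
    rw [Metric.cauchySeq_iff'] at hc ⊢
    intro δ hδ
    obtain ⟨N, hN⟩ := hc (Real.pi * δ) (mul_pos Real.pi_pos hδ)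
    refine ⟨N, fun n hn => (hd n N).trans_lt ?_⟩
    rw [inv_mul_lt_iff₀ Real.pi_pos]
    exact hN n hn
  obtain ⟨f, hf⟩ := cauchySeq_tendsto_of_complete hc1
  have e : (fun x => expo κ x * (expo (-κ) x * f x)) = f := by
    funext x
    rw [← mul_assoc, mul_comm (expo κ x), expo_neg_mul_expo, one_mul]
  refine ⟨fun x => expo (-κ) x * f x, ?_⟩
  rw [e]
  refine mem_pairClosure_of_tendsto (Lp.memLp f) hP
    (q := fun k => (fun x => expo κ x * φ k x, grad fun x => expo κ x * φ k x))
    (fun k => ⟨φ k, hφ k, rfl⟩) ?_ h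
  refine (tendsto_toLp_iff (Lp.memLp f) m1).1 ?_
  rwa [Lp.toLp_coeFn]

lemma exists_cellSolution (hμ : Admissible μ) (hA : IsCoefficient A) {κ : R3}
    (hκ : κ ∈ dualCell) : ∃ Ψ P, IsCellSolution μ A κ Ψ P := by
  obtain ⟨c, -, h1, -⟩ := hA.exists_bounds
  have hm : ∀ φ, MemLp (cellMap hμ A κ φ) 2 (onCell μ) := fun φ =>
    hA.memLp_act_isqrt (memLp_grad hμ κ φ.2.1)
  suffices h : ∀ j : Fin 3, ∃ (Ψ : R3 → ℂ) (P : R3 → C3),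
      ((fun x => expo κ x * Ψ x, P) : (R3 → ℂ) × (R3 → C3)) ∈ H1Zero μ κ ∧
      ∀ φ : R3 → ℂ, SmoothPerZero μ φ →
        ∫ x, inner ℂ (grad (fun y => expo κ y * φ y) x)
          (act (A x)⁻¹ (P x + expo κ x • EuclideanSpace.single j 1)) ∂(onCell μ) = 0 by
    choose Ψ P h using h
    exact ⟨Ψ, P, h⟩
  intro j
  have mg := hA.memLp_act_isqrt (memLp_expo_const hμ κ (EuclideanSpace.single j 1))
  -- The weight `A⁻¹` is absorbed by working with `A^{-1/2} ∇(e_κ φ)` in the unweighted space; `u`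
  -- is the projection of `-A^{-1/2} e_κ e_j`, and `A^{1/2} u` is the gradient sought.
  obtain ⟨u, hu, ho⟩ := exists_orthogonal (LinearMap.range (toLpLin (onCell μ) (cellMap hμ A κ) hm))
    (-mg.toLp)
  obtain ⟨q, hq, hqt⟩ := mem_closure_iff_seq_limit.1 hu
  choose φ hφ using hq
  have mu := Lp.memLp u
  have ht : Filter.Tendsto (fun k => eLpNorm ((u : R3 → C3) - cellMap hμ A κ (φ k)) 2 (onCell μ))
      Filter.atTop (nhds 0) := by
    refine (tendsto_toLp_iff mu fun k => hm (φ k)).1 ?_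
    rw [Lp.toLp_coeFn]
    rwa [show q = fun k => (hm (φ k)).toLp from funext fun k => (hφ k).symm] at hqt
  have ht2 := tendsto_eLpNorm_act h1 ht
  have e : ∀ k, (fun x => act (msqrt (A x)) (cellMap hμ A κ (φ k) x)) =
      grad fun x => expo κ x * (φ k).1 x := fun k => by
    funext x
    exact act_msqrt_isqrt (hA.posDef x) _
  simp only [e] at ht2
  obtain ⟨Ψ, hΨ⟩ := exists_scalar_limit hμ hκ (hA.memLp_act_msqrt mu) (fun k => (φ k).2) ht2
  refine ⟨Ψ, _, hΨ, fun ψ hψ => ?_⟩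
  have h2 := ho _ (Submodule.le_topologicalClosure _ ⟨⟨ψ, hψ⟩, rfl⟩)
  have m3 := hm ⟨ψ, hψ⟩
  have h3 : -mg.toLp - u = (mg.neg.sub mu).toLp := by
    rw [MemLp.toLp_sub mg.neg mu, MemLp.toLp_neg mg, Lp.toLp_coeFn]
  rw [h3] at h2
  have h4 := (inner_toLp m3 (mg.neg.sub mu)).symm.trans h2
  rw [← neg_eq_zero, ← integral_neg, ← h4]
  refine integral_congr_ae (Filter.Eventually.of_forall fun x => ?_)
  simp only [cellMap, LinearMap.coe_mk, AddHom.coe_mk, Pi.sub_apply, Pi.neg_apply,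
    inner_act_left (isSymm_isqrt _), act_sub, act_neg, act_add, ← act_isqrt_isqrt (hA.posDef x),
    act_isqrt_msqrt (hA.posDef x), inner_sub_right, inner_neg_right, inner_add_right]
  ring

/-! ### Solvability of the Maxwell system -/

/-- The smooth periodic vector fields. -/
def smoothPerSub : Submodule ℂ (R3 → C3) where
  carrier := {w | SmoothPer w}
  add_mem' hf hg := hf.add hg
  zero_mem' := SmoothPer.zero
  smul_mem' c _ hf := hf.const_smul c

/-- The map `w ↦ e_κ A^{-1/2} w`. -/
def fieldMap (A : R3 → Matrix (Fin 3) (Fin 3) ℝ) (κ : R3) :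
    smoothPerSub →ₗ[ℂ] (R3 → C3) where
  toFun w x := expo κ x • act (isqrt (A x)) (w.1 x)
  map_add' w z := by
    funext x
    simp only [Submodule.coe_add, Pi.add_apply, act_add, smul_add]
  map_smul' c w := by
    funext x
    simp only [Submodule.coe_smul, Pi.smul_apply, act_smul, RingHom.id_apply, smul_comm c]

/-- The map `w ↦ curl (e_κ w)`. -/
def curlMap (κ : R3) : smoothPerSub →ₗ[ℂ] (R3 → C3) where
  toFun w := curl fun x => expo κ x • w.1 x
  map_add' w z := curl_expo_add κ w.2 z.2
  map_smul' c w := curl_expo_const_smul κ c w.2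

lemma memLp_fieldMap (hμ : Admissible μ) (hA : IsCoefficient A) (κ : R3) (w : smoothPerSub) :
    MemLp (fieldMap A κ w) 2 (onCell μ) := (mem_H1Curl hμ hA κ w.2).1

lemma memLp_curlMap (hμ : Admissible μ) (κ : R3) (w : smoothPerSub) :
    MemLp (curlMap κ w) 2 (onCell μ) :=
  memLp_of_continuous hμ (continuous_curl (contDiff_expo_smul w.2 κ)) 2

/-- The map `w ↦ (e_κ A^{-1/2} w, ε⁻¹ curl (e_κ w))` into the Hilbert sum of two copies of `L²`. -/
def maxwellMap (hμ : Admissible μ) (hA : IsCoefficient A) (ε : ℝ) (κ : R3) :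
    smoothPerSub →ₗ[ℂ] WithLp 2 (Lp C3 2 (onCell μ) × Lp C3 2 (onCell μ)) :=
  (WithLp.linearEquiv 2 ℂ (Lp C3 2 (onCell μ) × Lp C3 2 (onCell μ))).symm.toLinearMap ∘ₗ
    (toLpLin (onCell μ) (fieldMap A κ) (memLp_fieldMap hμ hA κ)).prod
      ((ε : ℂ)⁻¹ • toLpLin (onCell μ) (curlMap κ) (memLp_curlMap hμ κ))

lemma maxwellMap_apply (hμ : Admissible μ) (hA : IsCoefficient A) (ε : ℝ) (κ : R3)
    (w : smoothPerSub) : maxwellMap hμ hA ε κ w =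
      WithLp.toLp 2 ((memLp_fieldMap hμ hA κ w).toLp,
        (ε : ℂ)⁻¹ • (memLp_curlMap hμ κ w).toLp) := rfl

lemma mem_closure_of_mem_H1Curl (hμ : Admissible μ) (hA : IsCoefficient A) (ε : ℝ) {κ : R3}
    {f V : R3 → C3} (h : (f, V) ∈ H1Curl μ A κ) :
    WithLp.toLp 2 ((h.1.toLp : Lp C3 2 (onCell μ)), (ε : ℂ)⁻¹ • (h.2.1.toLp : Lp C3 2 (onCell μ)))
      ∈ (LinearMap.range (maxwellMap hμ hA ε κ)).topologicalClosure := by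
  obtain ⟨q, hq, h1, h2⟩ := exists_seq_of_mem_pairClosure h
  choose φ hφ hqe using hq
  set w : ℕ → smoothPerSub := fun k => ⟨_, hφ k⟩
  have e1 : ∀ k, (q k).1 = fieldMap A κ (w k) := fun k => by
    rw [hqe]
    funext x
    simp only [fieldMap, LinearMap.coe_mk, AddHom.coe_mk, w, act_isqrt_msqrt (hA.posDef x)]
  have e2 : ∀ k, (q k).2 = curlMap κ (w k) := fun k => by rw [hqe]; rfl
  simp only [e1, e2] at h1 h2
  have t1 := (tendsto_toLp_iff h.1 fun k => memLp_fieldMap hμ hA κ (w k)).2 h1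
  have t2 := (tendsto_toLp_iff h.2.1 fun k => memLp_curlMap hμ κ (w k)).2 h2
  have t3 := ((WithLp.prod_continuous_toLp 2 _ _).tendsto _).comp
    (t1.prodMk_nhds (t2.const_smul (ε : ℂ)⁻¹))
  exact mem_closure_iff_seq_limit.2
    ⟨fun k => maxwellMap hμ hA ε κ (w k), fun k => ⟨w k, rfl⟩, t3⟩

/-- Together with `mem_closure_of_mem_H1Curl` this identifies the Sobolev space with a closed
subspace of a Hilbert sum, the curl being rescaled by `ε⁻¹` so that the inner product is the Maxwell
form. -/
lemma mem_H1Curl_of_mem_closure (hμ : Admissible μ) (hA : IsCoefficient A) {ε : ℝ} (hε : 0 < ε)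
    {κ : R3} {p : WithLp 2 (Lp C3 2 (onCell μ) × Lp C3 2 (onCell μ))}
    (h : p ∈ (LinearMap.range (maxwellMap hμ hA ε κ)).topologicalClosure) :
    ((p.fst : R3 → C3), (((ε : ℂ) • p.snd : Lp C3 2 (onCell μ)) : R3 → C3)) ∈ H1Curl μ A κ := by
  have hε0 : (ε : ℂ) ≠ 0 := by exact_mod_cast hε.ne'
  obtain ⟨q, hq, hqt⟩ := mem_closure_iff_seq_limit.1 h
  choose w hw using hq
  have t1 := ((WithLp.prod_continuous_ofLp 2 _ _).tendsto p).comp hqt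
  have t2 := (continuous_fst.tendsto _).comp t1
  have t3 := ((continuous_snd.tendsto _).comp t1).const_smul (ε : ℂ)
  have e1 : ∀ k, (q k).fst = (memLp_fieldMap hμ hA κ (w k)).toLp := fun k => by rw [← hw]; rfl
  have e2 : ∀ k, (ε : ℂ) • (q k).snd = (memLp_curlMap hμ κ (w k)).toLp := fun k => by
    rw [← hw, maxwellMap_apply]
    exact smul_inv_smul₀ hε0 _
  refine mem_pairClosure_of_tendsto (Lp.memLp _) (Lp.memLp _)
    (q := fun k => (fieldMap A κ (w k), curlMap κ (w k))) (fun k => ?_)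
    ((tendsto_toLp_iff (Lp.memLp _) fun k => memLp_fieldMap hμ hA κ (w k)).1 ?_)
    ((tendsto_toLp_iff (Lp.memLp _) fun k => memLp_curlMap hμ κ (w k)).1 ?_)
  · refine ⟨fun x => act (isqrt (A x)) ((w k).1 x), ?_, ?_⟩
    · simp only [act_msqrt_isqrt (hA.posDef _)]
      exact (w k).2
    · simp only [act_msqrt_isqrt (hA.posDef _)]
      rfl
  · rw [Lp.toLp_coeFn]
    simp only [← e1]
    exact t2
  · rw [Lp.toLp_coeFn]
    simp only [← e2]
    exact t3

lemma exists_maxwellSolution (hμ : Admissible μ) (hA : IsCoefficient A) {ε : ℝ} (hε : 0 < ε)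
    {θ : R3} {G : R3 → C3} (hG : MemLp G 2 (onCell μ)) :
    ∃ D B, IsMaxwellSolution μ A ε θ G D B := by
  have hε0 : (ε : ℂ) ≠ 0 := by exact_mod_cast hε.ne'
  set κ := ε • θ with hκ
  have mg := memLp_expo_smul κ (hA.memLp_act_msqrt hG)
  -- With `p = (e_κ D, ε⁻¹ V)` and `e_κ B = -ε⁻¹ V`, the second equation says that `(-e_κ A^{1/2} G,
  -- 0) - p` is orthogonal to the subspace.
  obtain ⟨p, hp, ho⟩ := exists_orthogonal (LinearMap.range (maxwellMap hμ hA ε κ))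
    (WithLp.toLp 2 (-(mg.toLp : Lp C3 2 (onCell μ)), 0))
  have hpm := mem_H1Curl_of_mem_closure hμ hA hε hp
  set V : Lp C3 2 (onCell μ) := (ε : ℂ) • p.snd with hV
  have eD : ∀ x, expo κ x • expo (-κ) x • (p.fst : R3 → C3) x = (p.fst : R3 → C3) x := fun x => by
    rw [smul_smul, mul_comm, expo_neg_mul_expo, one_smul]
  refine ⟨fun x => expo (-κ) x • (p.fst : R3 → C3) x,
    fun x => -((ε : ℂ)⁻¹ • (expo κ x)⁻¹ • (V : R3 → C3) x), ⟨V, ?_, ?_⟩, fun φ v hφ => ?_⟩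
  · simpa only [← hκ, eD] using hpm
  · exact Filter.Eventually.of_forall fun x => add_neg_cancel _
  · have h1 := ho _ (mem_closure_of_mem_H1Curl hμ hA ε hφ)
    have mp := Lp.memLp p.fst
    have mV := Lp.memLp V
    have hs : p.snd = (ε : ℂ)⁻¹ • mV.toLp := by
      rw [Lp.toLp_coeFn, hV, inv_smul_smul₀ hε0]
    have hf : p.fst = mp.toLp := (Lp.toLp_coeFn _ _).symm
    have h2 : -inner ℂ (hφ.1.toLp : Lp C3 2 (onCell μ)) mg.toLp
        - inner ℂ (hφ.1.toLp : Lp C3 2 (onCell μ)) mp.toLp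
        - (ε : ℂ)⁻¹ * ((ε : ℂ)⁻¹ * inner ℂ (hφ.2.1.toLp : Lp C3 2 (onCell μ)) mV.toLp) = 0 := by
      rw [← h1, WithLp.prod_inner_apply]
      simp only [WithLp.ofLp_sub, Prod.fst_sub, Prod.snd_sub, inner_sub_right, inner_neg_right,
        inner_zero_right, inner_smul_left, map_inv₀, Complex.conj_ofReal]
      rw [show (WithLp.ofLp p).1 = mp.toLp from hf,
        show (WithLp.ofLp p).2 = (ε : ℂ)⁻¹ • mV.toLp from hs, inner_smul_right]
      ring
    rw [inner_toLp, inner_toLp, inner_toLp] at h2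
    have e1 : ∀ x, inner ℂ (v x) (expo κ x • -((ε : ℂ)⁻¹ • (expo κ x)⁻¹ • (V : R3 → C3) x)) =
        -(ε : ℂ)⁻¹ * inner ℂ (v x) ((V : R3 → C3) x) := fun x => by
      rw [smul_neg, smul_comm (expo κ x), smul_inv_smul₀ (expo_ne_zero κ x), inner_neg_right,
        inner_smul_right, neg_mul]
    have e2 : ∀ x, inner ℂ (φ x) (expo (-κ) x • (p.fst : R3 → C3) x) =
        inner ℂ (expo κ x • φ x) ((p.fst : R3 → C3) x) := fun x => by
      rw [inner_smul_left, inner_smul_right, expo_neg]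
    simp only [← hκ, inner_expo_smul] at h2 ⊢
    simp only [e1, e2, integral_const_mul]
    linear_combination h2

end PeriodicMaxwell

end

theorem mainTheorem6 (μ : Measure PeriodicMaxwell.R3)
    (hμ : PeriodicMaxwell.Admissible μ)
    (A : PeriodicMaxwell.R3 → Matrix (Fin 3) (Fin 3) ℝ)
    (hA : PeriodicMaxwell.IsCoefficient A) :
    -- the cell problem and the transformed Maxwell system are solvable
    (∀ κ ∈ PeriodicMaxwell.dualCell, ∃ Ψ P, PeriodicMaxwell.IsCellSolution μ A κ Ψ P) ∧
    (∀ (ε : ℝ) (θ : PeriodicMaxwell.R3) (G : PeriodicMaxwell.R3 → PeriodicMaxwell.C3),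
      0 < ε → ε • θ ∈ PeriodicMaxwell.dualCell → PeriodicMaxwell.IsCurrent μ (ε • θ) G →
      ∃ D B, PeriodicMaxwell.IsMaxwellSolution μ A ε θ G D B) ∧
    -- the estimate, for all solutions, with one constant
    ∃ C : ℝ, 0 < C ∧
      ∀ (ε : ℝ) (θ : PeriodicMaxwell.R3) (G D B : PeriodicMaxwell.R3 → PeriodicMaxwell.C3)
        (Ψ : Fin 3 → PeriodicMaxwell.R3 → ℂ)
        (P : Fin 3 → PeriodicMaxwell.R3 → PeriodicMaxwell.C3),
        0 < ε → ε • θ ∈ PeriodicMaxwell.dualCell →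
        PeriodicMaxwell.IsCurrent μ (ε • θ) G →
        PeriodicMaxwell.IsCellSolution μ A (ε • θ) Ψ P →
        PeriodicMaxwell.IsMaxwellSolution μ A ε θ G D B →
        IsUnit (PeriodicMaxwell.homMatrix μ A (ε • θ) P).det ∧
        IsUnit (PeriodicMaxwell.symbolMatrix θ
          (PeriodicMaxwell.homMatrix μ A (ε • θ) P)).det ∧
        eLpNorm (fun x => B x - PeriodicMaxwell.iCross θ
            (PeriodicMaxwell.dVec μ θ (PeriodicMaxwell.homMatrix μ A (ε • θ) P) G))
            2 (PeriodicMaxwell.onCell μ)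
          ≤ ENNReal.ofReal (C * ε) * eLpNorm G 2 (PeriodicMaxwell.onCell μ) := by
  obtain ⟨c, hc, h1, h2⟩ := hA.exists_bounds
  refine ⟨fun κ hκ => PeriodicMaxwell.exists_cellSolution hμ hA hκ,
    fun ε θ G hε _ hG => PeriodicMaxwell.exists_maxwellSolution hμ hA hε hG.1,
    -- `c ^ 8` comes from the zero mode, `c ^ 2 + 1` from `F + g` in the others, and `1/π` from the
    -- spectral gap; `c` depends only on `A`.
    (c ^ 8 + c ^ 2 + 1) / Real.pi, by have := Real.pi_pos; positivity, ?_⟩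
  intro ε θ G D B Ψ P hε hκ hG hP h
  have hα : 0 < (c ^ 2)⁻¹ := by positivity
  have hco := hP.coercive hμ hA hc h1
  exact ⟨PeriodicMaxwell.isUnit_det_of_coercive hα hco,
    PeriodicMaxwell.isUnit_det_symbolMatrix hα hco θ,
    PeriodicMaxwell.eLpNorm_sub_iCross_dVec_le hμ hA hε hκ hc h1 h2 hG hP h⟩
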